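/- Let $\mathfrak g$ be a finite-dimensional complex simple Lie algebra of type $A_n$ ($n\ge 1$) or $D_n$ ($n\ge 4$), with Cartan subalgebra $\mathfrak h$, simple roots $\alpha_1,\dots,\alpha_n$ (Bourbaki labelling), simple coroots $h_i=h_{\alpha_i}$, positive roots $R^+$ and, for $\alpha\in R^+$, coroot $h_\alpha$ and nonzero root vectors $x_\alpha^{\pm}$ of weight $\pm\alpha$; write $x_i^-=x_{\alpha_i}^-$, let $\mathfrak n^+$ be the span of the $x_\alpha^+$, and let $P^+$ be the set of dominant integral weights. Let $\mathfrak g[t]=\mathfrak g\otimes\mathbb C[t]$ be the current algebra, graded by $\deg(x\otimes t^r)=r$. For $\nu\in P^+$ call the following relations on a vector $w$ the local Weyl relations of weight $\nu$: $$\mathfrak n^+[t]\,w=0,\qquad (h\otimes t^r)w=\delta_{r,0}\,\nu(h)w\ (h\in\mathfrak h,\ r\ge 0),\qquad (x_i^-\otimes 1)^{\nu(h_i)+1}w=0\ (1\le i\le n).$$ * For $\lambda,\mu\in P^+$, $V(\lambda,\mu)$ is the graded $\mathfrak g[t]$-module generated by an element $w_{\lambda,\mu}$ of degree $0$ with defining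 relations the local Weyl relations of weight $\lambda+\mu$ and $(x_\alpha^-\otimes t^{\max\{\lambda(h_\alpha),\mu(h_\alpha)\}})w_{\lambda,\mu}=0$ for all $\alpha\in R^+$. * For $\ell\ge 1$ and $\lambda\in P^+$, the stable level $\ell$ Demazure module $D(\ell,\lambda)$ is the graded $\mathfrak g[t]$-module generated by an element $w_\lambda$ of degree $0$ with defining relations the local Weyl relations of weight $\lambda$ and, for all $\alpha\in R^+$, $(x_\alpha^-\otimes t^{s_\alpha})w_\lambda=0$ and (if $s_\alpha\ge 1$) $(x_\alpha^-\otimes t^{s_\alpha-1})^{m_\alpha+1}w_\lambda=0$, where $\lambda(h_\alpha)=\ell(s_\alpha-1)+m_\alpha$ with integers $s_\alpha\ge 0$, $0<m_\alpha\le \ell$. A pair $(\nu_1,\nu_2)\in P^+\times P^+$ is called interlacing if $(\nu_1+\nu_2)(h_i)\le 1$ for all $i$ and, for $\{r,p\}=\{1,2\}$: * whenever $i<j$ and $\nu_r(h_i)=1=\nu_r(h_j)$ (in type $D_n$ only for $(i,j)\neq(n-1,n)$), there is $s$ with $i<s<j$ and $\nu_p(h_s)=1$; * in type $D_n$, moreover,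 $\nu_r(h_{n-1}+h_n)>0$ implies $\nu_p(h_{n-1}+h_n)=0$. **Proposition.** Let $(\nu_1,\nu_2)$ be an interlacing pair. For $\alpha\in R^+$ put $v_\alpha=(x_\alpha^-\otimes t^{\lceil(\nu_1+\nu_2)(h_\alpha)/2\rceil})\,w_{\nu_1,\nu_2}\in V(\nu_1,\nu_2)$. Then either $V(\nu_1,\nu_2)\cong D(2,\nu_1+\nu_2)$ as graded $\mathfrak g[t]$-modules, via $w_{\nu_1,\nu_2}\mapsto w_{\nu_1+\nu_2}$, or there is a unique root $\beta$ of minimal height in the set $\{\alpha\in R^+: v_\alpha\ne 0\}$ (which is then non-empty) and there is a short exact sequence of graded $\mathfrak g[t]$-modules $$0\to \langle v_\beta\rangle\to V(\nu_1,\nu_2)\to D(2,\nu_1+\nu_2)\to 0,$$ in which $\langle v_\beta\rangle$ is the submodule generated by $v_\beta$, the first map is the inclusion, and the second map sends $w_{\nu_1,\nu_2}$ to $w_{\nu_1+\nu_2}$. -/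

import Mathlib

open scoped TensorProduct Polynomial
open LieAlgebra LieAlgebra.IsKilling Module

noncomputable section

namespace CurrentAlg

/-- The two simply laced classical families of simple Lie algebras. -/
inductive SLType
  | A
  | D

/-- The Cartan matrix of type `A_n` or `D_n`. The nodes `1, …, n` of the usual (Bourbaki)
labelling are `0, …, n - 1` here; in type `D_n` the two end nodes of the fork are the last two. -/
def SLType.cartanMatrix : SLType → (n : ℕ) → Matrix (Fin n) (Fin n) ℤ
  | .A, n => CartanMatrix.A n
  | .D, n => CartanMatrix.D n

/-- The least rank: `A_n` for `n ≥ 1`, `D_n` for `n ≥ 4`. -/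
def SLType.minRank : SLType → ℕ
  | .A => 1
  | .D => 4

section Current

variable (L : Type*) [LieRing L] [LieAlgebra ℂ L]

/-- The universal enveloping algebra `U(𝔤[t])` of the current algebra `𝔤[t] = ℂ[t] ⊗ 𝔤`,
viewed as a complex Lie algebra. Left `U(𝔤[t])`-modules are the same as `𝔤[t]`-modules. -/
abbrev CurrentEnv : Type _ := UniversalEnvelopingAlgebra ℂ (ℂ[X] ⊗[ℂ] L)

variable {L}

/-- The element `x ⊗ t ^ r` of `𝔤[t]`, inside `U(𝔤[t])`. -/
def cur (x : L) (r : ℕ) : CurrentEnv L :=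
  UniversalEnvelopingAlgebra.ι ℂ ((Polynomial.X ^ r : ℂ[X]) ⊗ₜ[ℂ] x)

variable (L) in
/-- The degree `k` part of `U(𝔤[t])`, for the grading in which `x ⊗ t ^ r` has degree `r`. -/
def envDegree (k : ℕ) : Submodule ℂ (CurrentEnv L) :=
  Submodule.span ℂ
    {u | ∃ l : List (L × ℕ), (l.map Prod.snd).sum = k ∧
      u = (l.map fun p => cur p.1 p.2).prod}

/-- The `𝔤[t]`-module with one generator `w` and the defining relations `u w = 0` for `u ∈ rel`. -/
abbrev CyclicModule (rel : Set (CurrentEnv L)) : Type _ :=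
  CurrentEnv L ⧸ Submodule.span (CurrentEnv L) rel

/-- The generator of a module given by generator and relations. -/
def gen (rel : Set (CurrentEnv L)) : CyclicModule rel := Submodule.Quotient.mk 1

/-- The degree `k` part of a module given by a generator and (homogeneous) relations; the
generator has degree zero. -/
def degreePart (rel : Set (CurrentEnv L)) (k : ℕ) : Submodule ℂ (CyclicModule rel) :=
  (envDegree L k).map
    ((Submodule.mkQ (Submodule.span (CurrentEnv L) rel)).restrictScalars ℂ)

/-- The map `f` preserves degrees. -/
def IsGraded {rel rel' : Set (CurrentEnv L)}
    (f : CyclicModule rel →ₗ[CurrentEnv L] CyclicModule rel') : Prop :=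
  ∀ k, ∀ v ∈ degreePart rel k, f v ∈ degreePart rel' k

end Current

section Weights

theorem isPos_flip {ι M N : Type*} [Finite ι] [AddCommGroup M] [Module ℂ M] [AddCommGroup N]
    [Module ℂ N] {P : RootPairing ι ℂ M N} [P.IsCrystallographic] [P.IsReduced] (b : P.Base)
    {i : ι} (hi : b.IsPos i) : b.flip.IsPos i := by
  refine hi.induction_on_reflect (p := fun k => b.IsPos k → b.flip.IsPos k)
    (fun j hj _ => RootPairing.Base.isPos_of_mem_support hj) ?_ hi
  intro i j hij hj hpos
  by_cases hne : P.reflectionPerm j i = j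
  · rw [hne]
    exact RootPairing.Base.isPos_of_mem_support hj
  · have hi : b.IsPos i := by
      simpa using hpos.reflectionPerm hj hne
    have hij' : i ≠ j := by
      rintro rfl
      let := P.indexNeg
      exact (RootPairing.Base.IsPos.neg_iff_not b i).mp hpos hi
    exact (hij hi).reflectionPerm (b := b.flip) hj hij'


variable {L : Type*} [LieRing L] [LieAlgebra ℂ L] [FiniteDimensional ℂ L]
  [LieAlgebra.IsKilling ℂ L] {H : LieSubalgebra ℂ L} [H.IsCartanSubalgebra]

/-- The dominant integral weights `P⁺`. -/
def IsDominant (b : (rootSystem H).Base) (lam : Dual ℂ H) : Prop :=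
  ∀ i ∈ b.support, ∃ k : ℕ, lam ((rootSystem H).coroot i) = k

/-- The natural number `λ(h_α)`, for `λ` dominant integral and `α` a positive root; see
`coe_ev`. -/
def ev (lam : Dual ℂ H) (α : H.root) : ℕ :=
  ⌊(lam ((rootSystem H).coroot α)).re⌋₊

/-- `λ(h_α)` is indeed a natural number. -/
theorem coe_ev {b : (rootSystem H).Base} {lam : Dual ℂ H} (hlam : IsDominant b lam)
    {α : H.root} (hα : b.IsPos α) :
    (ev lam α : ℂ) = lam ((rootSystem H).coroot α) := by
  suffices ∃ k : ℕ, lam ((rootSystem H).coroot α) = k by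
    obtain ⟨k, hk⟩ := this
    rw [ev, hk, Complex.natCast_re, Nat.floor_natCast]
  obtain ⟨f, hf₀, hf₁, hf₂⟩ := b.flip.exists_root_eq_sum_int α
  have hpos := isPos_flip b hα
  rw [RootPairing.Base.isPos_iff, RootPairing.Base.height_eq_sum hf₂] at hpos
  replace hf₁ : 0 < f := by
    refine hf₁.resolve_right fun hneg => ?_
    exact absurd hpos (not_lt.mpr (Finset.sum_nonpos fun i _ => hneg.le i))
  replace hf₂ : (rootSystem H).coroot α = ∑ j ∈ b.support, f j • (rootSystem H).coroot j := hf₂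
  rw [hf₂, map_sum]
  choose! g hg using hlam
  refine ⟨∑ j ∈ b.support, (f j).toNat * g j, ?_⟩
  push_cast
  refine Finset.sum_congr rfl fun j hj => ?_
  rw [map_zsmul, hg j hj, zsmul_eq_mul]
  congr 1
  have := Int.toNat_of_nonneg (hf₁.le j)
  exact_mod_cast this.symm

/-- The relations `𝔫⁺[t] w = 0`, `(h ⊗ t ^ r) w = δ_{r,0} λ(h) w` and
`(x_i⁻ ⊗ 1) ^ (λ(h_i) + 1) w = 0` of the local Weyl module. Root spaces are one-dimensional, so
that the choice of the root vectors is immaterial. -/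
def localWeylRel (b : (rootSystem H).Base) (lam : Dual ℂ H) : Set (CurrentEnv L) :=
  {u | ∃ α : H.root, b.IsPos α ∧ ∃ x ∈ rootSpace H α.1, ∃ r : ℕ, u = cur x r} ∪
  {u | ∃ (h : H) (r : ℕ),
    u = cur (h : L) r - algebraMap ℂ (CurrentEnv L) (if r = 0 then lam h else 0)} ∪
  {u | ∃ i ∈ b.support, ∃ y ∈ rootSpace H (-i.1), u = cur y 0 ^ (ev lam i + 1)}

/-- The defining relations of `V(λ, μ)`, for `𝔤` simply laced: those of the local Weyl module of
highest weight `λ + μ`, and `(x_α⁻ ⊗ t ^ max {λ(h_α), μ(h_α)}) w = 0` for all `α ∈ R⁺`. -/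
def vRel (b : (rootSystem H).Base) (lam mu : Dual ℂ H) : Set (CurrentEnv L) :=
  localWeylRel b (lam + mu) ∪
  {u | ∃ α : H.root, b.IsPos α ∧ ∃ y ∈ rootSpace H (-α.1),
    u = cur y (max (ev lam α) (ev mu α))}

/-- The defining relations of the level `ℓ` Demazure module `D(ℓ, λ)`, for `𝔤` simply laced
(`d_α = 1` for all `α`): those of the local Weyl module of highest weight `λ`, and
`(x_α⁻ ⊗ t ^ s) w = 0`, `(x_α⁻ ⊗ t ^ (s - 1)) ^ (m + 1) w = 0` for all `α ∈ R⁺`, where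
`λ(h_α) = ℓ (s - 1) + m` with `0 < m ≤ ℓ`. If `λ(h_α) = 0` then `s = 0`, and the second relation
is void. -/
def demazureRel (b : (rootSystem H).Base) (l : ℕ) (lam : Dual ℂ H) : Set (CurrentEnv L) :=
  localWeylRel b lam ∪
  {u | ∃ α : H.root, b.IsPos α ∧ ∃ y ∈ rootSpace H (-α.1), ∃ s m : ℕ,
    0 < m ∧ m ≤ l ∧ ev lam α + l = l * s + m ∧
      (u = cur y s ∨ (0 < s ∧ u = cur y (s - 1) ^ (m + 1)))}

/-- The module `V(λ, μ)`. -/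
abbrev V (b : (rootSystem H).Base) (lam mu : Dual ℂ H) : Type _ := CyclicModule (vRel b lam mu)

/-- The (stable) level `ℓ` Demazure module `D(ℓ, λ)`. -/
abbrev Demazure (b : (rootSystem H).Base) (l : ℕ) (lam : Dual ℂ H) : Type _ :=
  CyclicModule (demazureRel b l lam)

/-- One half of the interlacing condition, for `l i = λ_r(h_i)` and `m i = λ_p(h_i)`: whenever
`λ_r(h_i) = 1 = λ_r(h_j)` with `i < j`, there is `i < s < j` with `λ_p(h_s) = 1`. In type `D_n` the
two end nodes `n - 1`, `n` of the fork are exempt from this, and instead `λ_r(h_{n-1} + h_n) > 0`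
forces `λ_p(h_{n-1} + h_n) = 0`. -/
def Alternates {n : ℕ} (l m : Fin n → ℕ) : SLType → Prop
  | .A => ∀ i j : Fin n, i < j → l i = 1 → l j = 1 → ∃ s, i < s ∧ s < j ∧ m s = 1
  | .D =>
    (0 < ∑ i ∈ Finset.univ.filter (fun i : Fin n => n ≤ (i : ℕ) + 2), l i →
      ∑ i ∈ Finset.univ.filter (fun i : Fin n => n ≤ (i : ℕ) + 2), m i = 0) ∧
    ∀ i j : Fin n, i < j → ¬ ((i : ℕ) + 2 = n ∧ (j : ℕ) + 1 = n) →
      l i = 1 → l j = 1 → ∃ s, i < s ∧ s < j ∧ m s = 1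

/-- Interlacing pairs of dominant weights; `e` labels the simple roots. -/
def IsInterlacing (X : SLType) {b : (rootSystem H).Base} {n : ℕ} (e : Fin n ≃ b.support)
    (lam mu : Dual ℂ H) : Prop :=
  (∀ i, ev (lam + mu) (e i) ≤ 1) ∧
  Alternates (fun i => ev lam (e i)) (fun i => ev mu (e i)) X ∧
  Alternates (fun i => ev mu (e i)) (fun i => ev lam (e i)) X

/-- The vector `(y_α ⊗ t ^ ⌈(λ + μ)(h_α) / 2⌉) w` of `V(λ, μ)`. -/
def kerVec (b : (rootSystem H).Base) (lam mu : Dual ℂ H) (y : H.root → L) (α : H.root) :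
    V b lam mu :=
  cur (y α) ⌈(ev (lam + mu) α : ℚ) / 2⌉₊ • gen (vRel b lam mu)

end Weights

end CurrentAlg

end

/-! Write `d(α) = (ν₁ - ν₂)(h_α)`. The exponent `max {ν₁(h_α), ν₂(h_α)}` in `V(ν₁, ν₂)` equals the
exponent `⌈(ν₁ + ν₂)(h_α) / 2⌉` of the level two Demazure module exactly when `|d(α)| ≤ 1`, and
exceeds it otherwise. Hence the Demazure module is a quotient of `V(ν₁, ν₂)`. The power relations of
the Demazure module follow from the linear ones by a Garland type argument
(`pow_smul_eq_zero_of_garland`, `smul_gen_mem_of_mem_demazureRel`), so the kernel is generated by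
the `v_α` with `|d(α)| ≥ 2`, the exceptional roots.

In type A the value `d(ε_p - ε_q)` is a sum of consecutive entries `0, 1, -1` whose nonzero terms
alternate in sign, so there is no exceptional root and the two modules agree. In type D let `G_i` be
twice the value of `ν₁ - ν₂` on `ε_i`. Interlacing gives `|G_i| ≤ 2` for all `i` but the last, and
the exceptional roots are `ε_p + ε_q` with `p, q` in the set `O` of such indices with `|G_i| = 2`.
On `O` all `G_i` agree. The two largest indices in `O` give the exceptional root `β` of least
height, and any other exceptional root arises from `β` by adding at most two roots `δ = ε_p -
ε_{p'}` with `d(δ) = 0` (`exists_minimal_of_alternates_D`).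

If `d(δ) = 0`, then `x_δ⁻ ⊗ t ^ ν₁(h_δ)` kills the generator, and its commutator with `x_β⁻ ⊗ t ^ s`
puts `v_{β+δ}` into `⟨v_β⟩` (`cur_smul_gen_mem_of_reflTransGen`). So `v_β` generates the kernel: if
`v_β = 0` the modules are isomorphic, otherwise the exact sequence results. -/

noncomputable section

namespace CurrentAlg

/-! ### Commutation past powers in an associative ring -/

section RingIdentities

variable {A : Type*} [Ring A]

/-- Commuting an element past a power, when the commutator is central for that power. -/
theorem mul_pow_of_commute {k f g : A} (h : k * f = f * k + g) (hg : Commute g f) (r : ℕ) :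
    k * f ^ (r + 1) = f ^ (r + 1) * k + (r + 1) * (g * f ^ r) := by
  induction r with
  | zero => simp [h]
  | succ r ih =>
    have hc : g * f ^ (r + 1) = f ^ (r + 1) * g := (hg.pow_right _).eq
    rw [pow_succ f (r + 1), ← mul_assoc, ih, add_mul, mul_assoc (f ^ (r + 1)), h]
    have : ((r : A) + 1) * (g * f ^ r) * f = (r + 1) * (g * f ^ (r + 1)) := by
      rw [mul_assoc, mul_assoc, ← pow_succ]
    rw [this, mul_add, ← hc, mul_assoc]
    push_cast
    noncomm_ring

/-- Commuting an element past a power, when the second commutator is central for that power. -/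
theorem mul_pow_of_commute_commutator {e f k g : A} (he : e * f = f * e + k)
    (hk : k * f = f * k - 2 * g) (hg : Commute g f) (r : ℕ) :
    e * f ^ (r + 1) = f ^ (r + 1) * e + (r + 1) * (f ^ r * k) - (r + 1) * r * (g * f ^ (r - 1)) := by
  have hg' : Commute (-2 * g) f := by
    rw [neg_mul, Commute.neg_left_iff]
    exact (Commute.ofNat_left 2 f).mul_left hg
  have hk' : k * f = f * k + -2 * g := by rw [hk]; noncomm_ring
  induction r with
  | zero => simp [he]
  | succ r ih =>
    have h1 := mul_pow_of_commute hk' hg' r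
    have hcn : ∀ n : ℕ, ((n : A)) * f = f * n := fun n => (Nat.cast_commute n f).eq
    have hfg : f * (g * f ^ (r - 1)) * (r : A) = (r : A) * (g * f ^ r) := by
      rcases r with _ | r
      · simp
      · rw [(Nat.cast_commute (r + 1) _).eq, Nat.add_sub_cancel, ← mul_assoc f, ← hg.eq, mul_assoc g,
          ← pow_succ']
    rw [pow_succ' f (r + 1), ← mul_assoc, he, add_mul, mul_assoc f, ih, h1, mul_sub, mul_add]
    have e1 : f * (((r : A) + 1) * (f ^ r * k)) = (r + 1) * (f ^ (r + 1) * k) := by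
      have := hcn (r + 1)
      push_cast at this
      rw [← mul_assoc, ← this, mul_assoc, ← mul_assoc f, ← pow_succ']
    have e2 : f * (((r : A) + 1) * r * (g * f ^ (r - 1))) = (r + 1) * (r * (g * f ^ r)) := by
      have := hcn (r + 1)
      push_cast at this
      rw [← hfg, mul_assoc ((r : A) + 1), ← mul_assoc f, ← this, mul_assoc ((r : A) + 1),
        (Nat.cast_commute r _).eq, mul_assoc f]
    rw [e1, e2]
    push_cast
    noncomm_ring

end RingIdentities

section Cancel

variable {A M : Type*} [Ring A] [Algebra ℂ A] [AddCommGroup M] [Module A M]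

theorem eq_zero_of_intCast_smul {k : ℤ} (hk : k ≠ 0) {m : M} (h : (k : A) • m = 0) : m = 0 := by
  have : (algebraMap ℂ A (k : ℂ)⁻¹ * (k : A)) = 1 := by
    rw [← map_intCast (algebraMap ℂ A), ← map_mul, inv_mul_cancel₀ (by exact_mod_cast hk), map_one]
  rw [← one_smul A m, ← this, mul_smul, h, smul_zero]

end Cancel

/-! ### Nilpotency in representations of the Heisenberg algebra -/

section Heisenberg

variable {A M : Type*} [Ring A] [Algebra ℂ A] [AddCommGroup M] [Module A M]

/-- Applying `y` to `x ^ (a + 1) u = 0` gives a nonzero multiple of `x ^ a z u`. So `z u` satisfies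
the hypotheses with `a` in place of `a + 1`, and induction applies. -/
theorem pow_smul_eq_zero_of_smul_eq_zero {x y z : A} (hz : x * y = y * x + z)
    (hx : Commute z x) (hy : Commute z y) (a : ℕ) {u : M} (hu : y • u = 0)
    (hxu : x ^ a • u = 0) : z ^ a • u = 0 := by
  induction a generalizing u with
  | zero => simpa using hxu
  | succ a ih =>
    have h1 : y * x = x * y + -z := by rw [hz]; abel
    have h2 := mul_pow_of_commute h1 hx.neg_left a
    have h3 : ((a : A) + 1) * (z * x ^ a) = x ^ (a + 1) * y - y * x ^ (a + 1) := by
      rw [h2]; noncomm_ring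
    have h4 : (((a : ℤ) + 1 : ℤ) : A) • (x ^ a • z • u) = 0 := by
      rw [← mul_smul (x ^ a), ← mul_smul, ← (hx.pow_right a).eq]
      push_cast
      rw [h3, sub_smul, mul_smul, mul_smul, hu, hxu, smul_zero, smul_zero, sub_zero]
    have h5 := eq_zero_of_intCast_smul (by positivity) h4
    rw [pow_succ, mul_smul]
    refine ih ?_ h5
    rw [← mul_smul, ← hy.eq, mul_smul, hu, smul_zero]

/-- In a representation of the Heisenberg algebra, the centre acts nilpotently on a vector on which
both generators do. -/
theorem exists_pow_smul_eq_zero {x y z : A} (hz : x * y = y * x + z)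
    (hx : Commute z x) (hy : Commute z y) (a c : ℕ) {w : M} (hyw : y ^ c • w = 0)
    (hxw : x ^ a • w = 0) : ∃ N : ℕ, z ^ N • w = 0 := by
  induction c generalizing a w with
  | zero => exact ⟨0, by simpa using hyw⟩
  | succ c ih =>
    -- The induction hypothesis applies to `y w`, which needs one more power of `x`. Then `z ^ N w`
    -- is killed by `y`, and the preceding lemma finishes.
    obtain ⟨N, hN⟩ : ∃ N : ℕ, z ^ N • y • w = 0 := by
      refine ih (a + 1) (by rwa [← mul_smul, ← pow_succ]) ?_
      have := mul_pow_of_commute (show y * x = x * y + -z by rw [hz]; abel) hx.neg_left a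
      have h3 : x ^ (a + 1) * y = (y * x + (a + 1) * z) * x ^ a := by
        rw [← sub_eq_iff_eq_add.mpr this, pow_succ']; noncomm_ring
      rw [← mul_smul, h3, mul_smul, hxw, smul_zero]
    refine ⟨a + N, ?_⟩
    rw [pow_add, mul_smul]
    refine pow_smul_eq_zero_of_smul_eq_zero hz hx hy a ?_ ?_
    · rw [← mul_smul, ← (hy.pow_left N).eq, mul_smul, hN]
    · rw [← mul_smul, ← (hx.pow_pow N a).eq, mul_smul, hxw, smul_zero]

end Heisenberg

/-! ### Highest weight vectors for `𝔰𝔩₂` -/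

section SlTwo

variable {A M : Type*} [Ring A] [Algebra ℂ A] [AddCommGroup M] [Module A M]

/-- A highest weight vector of weight `l` on which `f` acts nilpotently is killed by
`f ^ (l + 1)`. -/
theorem pow_succ_smul_eq_zero {e f h : A} (he : e * f = f * e + h) (hh : h * f = f * h - 2 * f)
    {w : M} {l : ℕ} (hew : e • w = 0) (hhw : h • w = (l : A) • w) {N : ℕ}
    (hN : f ^ N • w = 0) : f ^ (l + 1) • w = 0 := by
  -- Here `e f ^ (k + 1) w = (k + 1)(l - k) f ^ k w`, and the scalar is nonzero for `k > l`.
  have key : ∀ k : ℕ, l < k → f ^ (k + 1) • w = 0 → f ^ k • w = 0 := by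
    intro k hk h0
    have h1 := mul_pow_of_commute_commutator he hh (Commute.refl f) k
    have h2 : e • f ^ (k + 1) • w = (((k + 1) * (l - k) : ℤ) : A) • f ^ k • w := by
      have h3 : ((k : A) + 1) * k * (f * f ^ (k - 1)) = (k + 1) * k * f ^ k := by
        rcases k with _ | k
        · simp
        · rw [Nat.add_sub_cancel, ← pow_succ']
      rw [← mul_smul, h1, h3, sub_smul, add_smul, mul_smul _ e, hew, smul_zero, zero_add, mul_smul,
        mul_smul, hhw, ← mul_smul _ (l : A), ← (Nat.cast_commute l _).eq, mul_smul (l : A),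
        ← mul_smul, mul_smul (_ * _), ← sub_smul]
      congr 1
      push_cast
      noncomm_ring
    rw [h0, smul_zero] at h2
    refine eq_zero_of_intCast_smul ?_ h2.symm
    apply mul_ne_zero <;> omega
  by_contra hne
  have : ∀ k : ℕ, f ^ (l + 1 + k) • w ≠ 0 := by
    intro k
    induction k with
    | zero => exact hne
    | succ k ih => exact fun h => ih (key _ (by omega) h)
  refine this N ?_
  rw [pow_add, mul_smul, hN, smul_zero]

end SlTwo

/-! ### Garland type identities by generating functions -/

section Garland

open PowerSeries

variable {A M : Type*} [Ring A] [AddCommGroup M] [Module A M]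

theorem powerSeries_commute {f g : A⟦X⟧} (h : ∀ i j, Commute (coeff i f) (coeff j g)) :
    Commute f g := by
  ext n
  rw [coeff_mul, coeff_mul, ← Finset.Nat.sum_antidiagonal_swap]
  exact Finset.sum_congr rfl fun p _ => (h _ _).eq

/-- The operator `X d/dX` on formal power series. -/
def euler (f : A⟦X⟧) : A⟦X⟧ := PowerSeries.mk fun n => (n : A) * coeff n f

theorem coeff_euler (f : A⟦X⟧) (n : ℕ) : coeff n (euler f) = n * coeff n f := coeff_mk _ _

theorem euler_mul (f g : A⟦X⟧) : euler (f * g) = euler f * g + f * euler g := by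
  ext n
  rw [map_add, coeff_euler, coeff_mul, coeff_mul, coeff_mul, Finset.mul_sum,
    ← Finset.sum_add_distrib]
  refine Finset.sum_congr rfl fun p hp => ?_
  rw [coeff_euler, coeff_euler, ← Finset.HasAntidiagonal.mem_antidiagonal.mp hp, ← mul_assoc (coeff p.1 f),
    ← (Nat.cast_commute p.2 (coeff p.1 f)).eq]
  push_cast
  noncomm_ring

theorem euler_pow {f : A⟦X⟧} (h : Commute (euler f) f) (r : ℕ) :
    euler (f ^ r) = r * (euler f * f ^ (r - 1)) := by
  induction r with
  | zero =>
    ext n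
    rw [coeff_euler]
    rcases n with _ | n <;> simp [coeff_one]
  | succ r ih =>
    rw [pow_succ', euler_mul, ih, Nat.add_sub_cancel]
    rcases r with _ | r
    · simp
    · rw [Nat.add_sub_cancel, ← mul_assoc f, ← (Nat.cast_commute (r + 1) f).eq, mul_assoc _ f,
        ← mul_assoc f, ← h.eq, mul_assoc _ f, ← pow_succ']
      push_cast
      noncomm_ring

/-- The action of `x⁺ ⊗ t` on the generating function of the products of `r + 1` elements
`x⁻ ⊗ t ^ j`. -/
theorem smul_coeff_pow_smul {E : A} {Y K : ℕ → A} (hY : ∀ i j, Commute (Y i) (Y j))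
    (hE : ∀ j, E * Y j = Y j * E + K (j + 1))
    (hK : ∀ k j, K (k + 1) * Y j = Y j * K (k + 1) - 2 * Y (j + k + 1))
    {w : M} (hEw : E • w = 0) (hKw : ∀ k, K (k + 1) • w = 0) (r N : ℕ) :
    E • coeff N ((X * PowerSeries.mk Y) ^ (r + 1)) • w =
      -((((r + 1) * (N - r) : ℤ) : A) • coeff N ((X * PowerSeries.mk Y) ^ r) • w) := by
  set f : A⟦X⟧ := X * PowerSeries.mk Y with hf
  set k : A⟦X⟧ := X * PowerSeries.mk (fun j => K (j + 1)) with hk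
  have hfc0 : coeff 0 f = 0 := by simp [hf]
  have hfc : ∀ n, coeff (n + 1) f = Y n := fun n => by simp [hf, coeff_succ_X_mul]
  have hkc0 : coeff 0 k = 0 := by simp [hk]
  have hkc : ∀ n, coeff (n + 1) k = K (n + 1) := fun n => by simp [hk, coeff_succ_X_mul]
  have hff : ∀ i j, Commute (coeff i f) (coeff j f) := by
    rintro (_ | i) (_ | j) <;> simp [hfc0, hfc, hY]
  have hθ : Commute (euler f) f := powerSeries_commute fun i j => by
    rw [coeff_euler]
    exact (Nat.cast_commute _ _).mul_left (hff i j)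
  have h1 : C E * f = f * C E + k := by
    ext (_ | n)
    · rw [map_add, coeff_C_mul, coeff_mul_C, hfc0, hkc0]; simp
    · rw [map_add, coeff_C_mul, coeff_mul_C, hfc, hkc, hE]
  -- The commutator of `K p` with the degree `q` coefficient of `f` depends only on `p + q`, and `n
  -- = p + q` with `p, q ≥ 1` has `n - 1` solutions. This is the coefficientwise effect of `euler f
  -- - f`.
  have h2 : k * f = f * k - 2 * (euler f - f) := by
    have hterm : ∀ p q : ℕ, coeff p k * coeff q f = coeff q f * coeff p k -
        2 * ((if p = 0 ∨ q = 0 then 0 else 1) * coeff (p + q) f) := by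
      rintro (_ | p) (_ | q)
      · simp [hfc0]
      · simp [hkc0]
      · simp [hfc0]
      · rw [hkc, hfc, hK, show p + 1 + (q + 1) = q + p + 1 + 1 by ring, hfc]
        simp
    have hcount : ∀ n : ℕ, (∑ p ∈ Finset.HasAntidiagonal.antidiagonal (n + 1),
        (if p.1 = 0 ∨ p.2 = 0 then 0 else 1 : A)) = n := by
      intro n
      rw [Finset.Nat.sum_antidiagonal_eq_sum_range_succ_mk, Finset.sum_range_succ,
        Finset.sum_range_succ']
      rw [Finset.sum_congr rfl (g := fun _ => (1 : A))]
      · simp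
      · intro i hi
        have := Finset.mem_range.mp hi
        rw [if_neg]
        simp only [not_or]
        omega
    ext n
    have hn : coeff n (2 * (euler f - f)) = 2 * (coeff n (euler f) - coeff n f) := by
      rw [two_mul, two_mul, map_add, map_sub]
    have hs : ∑ p ∈ Finset.HasAntidiagonal.antidiagonal n,
        (if p.1 = 0 ∨ p.2 = 0 then 0 else 1) * coeff (p.1 + p.2) f =
        (∑ p ∈ Finset.HasAntidiagonal.antidiagonal n,
          (if p.1 = 0 ∨ p.2 = 0 then 0 else 1)) * coeff n f := by
      rw [Finset.sum_mul]
      exact Finset.sum_congr rfl fun p hp => by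
        rw [Finset.HasAntidiagonal.mem_antidiagonal.mp hp]
    rw [map_sub, hn, coeff_mul, coeff_mul, ← Finset.Nat.sum_antidiagonal_swap (f := fun p =>
      coeff p.1 f * coeff p.2 k), Finset.sum_congr rfl fun p _ => hterm p.1 p.2,
      Finset.sum_sub_distrib, ← Finset.mul_sum, hs, coeff_euler]
    simp only [Prod.fst_swap, Prod.snd_swap]
    rcases n with _ | n
    · simp [hfc0]
    · rw [hcount]
      push_cast
      noncomm_ring
  have hmul : ∀ (m : ℕ) (g : A⟦X⟧), coeff N ((m : A⟦X⟧) * g) = m * coeff N g := by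
    intro m g
    rw [← nsmul_eq_mul, map_nsmul, nsmul_eq_mul]
  -- Since `euler` is a derivation, `r (euler f - f) f ^ (r - 1) = euler (f ^ r) - r f ^ r`, whose
  -- degree `N` coefficient is `N - r` times that of `f ^ r`.
  have h3 : C E * f ^ (r + 1) = f ^ (r + 1) * C E + ((r + 1 : ℕ) : A⟦X⟧) * (f ^ r * k) -
      ((r + 1 : ℕ) : A⟦X⟧) * (euler (f ^ r) - (r : A⟦X⟧) * f ^ r) := by
    rw [mul_pow_of_commute_commutator h1 h2 (hθ.sub_left (Commute.refl f)) r, euler_pow hθ]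
    rcases r with _ | r
    · simp
    · rw [Nat.add_sub_cancel, pow_succ' f r]
      push_cast
      noncomm_ring
  have h4 : coeff N (f ^ r * k) • w = 0 := by
    rw [coeff_mul, Finset.sum_smul]
    refine Finset.sum_eq_zero fun p _ => ?_
    rw [mul_smul]
    rcases p.2 with _ | q
    · rw [hkc0, zero_smul, smul_zero]
    · rw [hkc, hKw, smul_zero]
  have h5 := congrArg (fun g => coeff N g • w) h3
  simp only [map_sub, map_add, coeff_C_mul, coeff_mul_C, hmul, coeff_euler, sub_smul, add_smul,
    mul_smul, hEw, h4, smul_zero, zero_add] at h5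
  rw [h5, zero_sub, neg_inj, ← sub_smul, ← mul_smul]
  push_cast
  rfl

variable [Algebra ℂ A]

/-- Descending induction on `r`. For `r = N` the coefficient is `Y 0 ^ N`; each step down applies
`E`, which produces the factor `(r + 1)(N - r)`, nonzero for `r < N`. -/
theorem coeff_pow_smul_eq_zero {E : A} {Y K : ℕ → A} (hY : ∀ i j, Commute (Y i) (Y j))
    (hE : ∀ j, E * Y j = Y j * E + K (j + 1))
    (hK : ∀ k j, K (k + 1) * Y j = Y j * K (k + 1) - 2 * Y (j + k + 1))
    {w : M} (hEw : E • w = 0) (hKw : ∀ k, K (k + 1) • w = 0) {N : ℕ} (hN : Y 0 ^ N • w = 0)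
    {r : ℕ} (hr : r ≤ N) : coeff N ((X * PowerSeries.mk Y) ^ r) • w = 0 := by
  induction hr using Nat.decreasingInduction with
  | self =>
    rw [(commute_X (PowerSeries.mk Y)).symm.mul_pow]
    have := coeff_X_pow_mul (PowerSeries.mk Y ^ N) N 0
    rw [zero_add] at this
    rw [this, coeff_zero_eq_constantCoeff, map_pow, ← coeff_zero_eq_constantCoeff_apply, coeff_mk,
      hN]
  | of_succ r hr ih =>
    have h1 := smul_coeff_pow_smul hY hE hK hEw hKw r N
    rw [ih, smul_zero, eq_comm, neg_eq_zero] at h1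
    exact eq_zero_of_intCast_smul (mul_ne_zero (by omega) (by omega)) h1

-- In total degree at least `r * d`, every monomial of length `r` other than `Y d ^ r` contains some
-- `Y k` with `k > d`, which can be moved next to `w`.
omit [Algebra ℂ A] in
theorem coeff_mk_pow_smul {Y : ℕ → A} (hY : ∀ i j, Commute (Y i) (Y j)) {w : M} {d : ℕ}
    (hd : ∀ k, d < k → Y k • w = 0) (r : ℕ) :
    (∀ n, r * d < n → coeff n (PowerSeries.mk Y ^ r) • w = 0) ∧
      coeff (r * d) (PowerSeries.mk Y ^ r) • w = Y d ^ r • w := by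
  have hc : ∀ (r n k : ℕ), Commute (Y k) (coeff n (PowerSeries.mk Y ^ r)) := by
    intro r
    induction r with
    | zero =>
      intro n k
      rw [pow_zero, coeff_one]
      split_ifs
      · exact Commute.one_right _
      · exact Commute.zero_right _
    | succ r ih =>
      intro n k
      rw [pow_succ, coeff_mul]
      refine Commute.sum_right _ _ _ fun p _ => (ih _ _).mul_right ?_
      rw [coeff_mk]
      exact hY _ _
  induction r with
  | zero =>
    refine ⟨fun n hn => ?_, by simp⟩
    rw [pow_zero, coeff_one, if_neg (by omega), zero_smul]
  | succ r ih =>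
    have hterm : ∀ p q : ℕ, r * d + d ≤ p + q → (p, q) ≠ (d, r * d) →
        (Y p * coeff q (PowerSeries.mk Y ^ r)) • w = 0 := by
      intro p q hpq hne
      rcases lt_trichotomy p d with h | h | h
      · rw [mul_smul, ih.1 q (by omega), smul_zero]
      · rw [mul_smul, ih.1 q ?_, smul_zero]
        refine lt_of_le_of_ne (by omega) fun h' => hne ?_
        rw [h, h']
      · rw [(hc r q p).eq, mul_smul, hd p h, smul_zero]
    have hsum : ∀ n, coeff n (PowerSeries.mk Y ^ (r + 1)) • w =
        ∑ p ∈ Finset.HasAntidiagonal.antidiagonal n, (Y p.1 * coeff p.2 (PowerSeries.mk Y ^ r)) • w := by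
      intro n
      rw [pow_succ', coeff_mul, Finset.sum_smul]
      simp
    refine ⟨fun n hn => ?_, ?_⟩
    · rw [hsum]
      refine Finset.sum_eq_zero fun p hp => hterm _ _ ?_ ?_
      · rw [Finset.HasAntidiagonal.mem_antidiagonal.mp hp, ← Nat.succ_mul]; exact hn.le
      · rintro h
        have := Finset.HasAntidiagonal.mem_antidiagonal.mp hp
        rw [Nat.succ_mul] at hn
        simp only [Prod.mk.injEq] at h
        omega
    · rw [hsum, Finset.sum_eq_single (d, r * d), mul_smul, ih.2, ← mul_smul, ← pow_succ']
      · intro p hp hne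
        refine hterm _ _ ?_ hne
        rw [Finset.HasAntidiagonal.mem_antidiagonal.mp hp, ← Nat.succ_mul]
      · intro h
        refine absurd (Finset.HasAntidiagonal.mem_antidiagonal.mpr ?_) h
        simp only
        ring

/-- If `w` is a highest weight vector for `𝔰𝔩₂[t]` with `(x⁻ ⊗ 1) ^ (l + 1) w = 0` and
`(x⁻ ⊗ t ^ k) w = 0` for all `k > d`, then `(x⁻ ⊗ t ^ d) ^ r w = 0` once `r (d + 1) > l`. -/
theorem pow_smul_eq_zero_of_garland {E : A} {Y K : ℕ → A} (hY : ∀ i j, Commute (Y i) (Y j))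
    (hE : ∀ j, E * Y j = Y j * E + K (j + 1))
    (hK : ∀ k j, K (k + 1) * Y j = Y j * K (k + 1) - 2 * Y (j + k + 1))
    {w : M} (hEw : E • w = 0) (hKw : ∀ k, K (k + 1) • w = 0) {l d r : ℕ}
    (hl : Y 0 ^ (l + 1) • w = 0) (hd : ∀ k, d < k → Y k • w = 0) (hr : l < r * (d + 1)) :
    Y d ^ r • w = 0 := by
  rw [← (coeff_mk_pow_smul hY hd r).2]
  -- The coefficient of degree `r * d` in `(mk Y) ^ r` is the one of degree `r * d + r = r * (d +
  -- 1)` in `(X * mk Y) ^ r`, and this degree exceeds `l`.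
  have hN : Y 0 ^ (r * d + r) • w = 0 := by
    obtain ⟨c, hc⟩ : ∃ c, r * d + r = c + (l + 1) :=
      ⟨r * d + r - (l + 1), by rw [Nat.sub_add_cancel]; rw [Nat.mul_succ] at hr; omega⟩
    rw [hc, pow_add, mul_smul, hl, smul_zero]
  have := coeff_pow_smul_eq_zero hY hE hK hEw hKw hN (Nat.le_add_left r (r * d))
  rwa [(commute_X (PowerSeries.mk Y)).symm.mul_pow, coeff_X_pow_mul] at this

end Garland

/-! ### Elements of the current algebra and cyclic modules -/

section Cur

attribute [local instance 100] LieRing.ofAssociativeRing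

variable {L : Type*} [LieRing L] [LieAlgebra ℂ L]

theorem cur_mul_cur (x y : L) (r s : ℕ) :
    cur x r * cur y s = cur y s * cur x r + cur ⁅x, y⁆ (r + s) := by
  have h : cur ⁅x, y⁆ (r + s) = cur x r * cur y s - cur y s * cur x r := by
    unfold cur
    rw [← LieRing.of_associative_ring_bracket, ← LieHom.map_lie, LieAlgebra.ExtendScalars.bracket_tmul,
      pow_add]
  rw [h]; abel

theorem cur_smul (c : ℂ) (x : L) (r : ℕ) : cur (c • x) r = c • cur x r := by
  unfold cur
  rw [TensorProduct.tmul_smul, map_smul]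

theorem cur_zero (r : ℕ) : cur (0 : L) r = 0 := by
  unfold cur
  rw [TensorProduct.tmul_zero, map_zero]

theorem cur_neg (x : L) (r : ℕ) : cur (-x) r = -cur x r := by
  unfold cur
  rw [TensorProduct.tmul_neg, map_neg]

theorem commute_cur {x y : L} (h : ⁅x, y⁆ = 0) (r s : ℕ) : Commute (cur x r) (cur y s) := by
  unfold Commute SemiconjBy
  rw [cur_mul_cur, h, cur_zero, add_zero]

theorem smul_gen_eq_mk (rel : Set (CurrentEnv L)) (u : CurrentEnv L) :
    u • gen rel = Submodule.Quotient.mk u := by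
  rw [gen, ← Submodule.Quotient.mk_smul, smul_eq_mul, mul_one]

theorem smul_gen_eq_zero {rel : Set (CurrentEnv L)} {u : CurrentEnv L} (hu : u ∈ rel) :
    u • gen rel = 0 := by
  rw [smul_gen_eq_mk, Submodule.Quotient.mk_eq_zero]
  exact Submodule.subset_span hu

/-- Maps between cyclic modules taking generator to generator are graded. -/
theorem isGraded_of_map_gen {rel rel' : Set (CurrentEnv L)}
    {f : CyclicModule rel →ₗ[CurrentEnv L] CyclicModule rel'} (hf : f (gen rel) = gen rel') :
    IsGraded f := by
  rintro k _ ⟨u, hu, rfl⟩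
  refine ⟨u, hu, ?_⟩
  change Submodule.Quotient.mk u = f (Submodule.Quotient.mk u)
  rw [← smul_gen_eq_mk, ← smul_gen_eq_mk, map_smul, hf]

/-- Comparison of a cyclic module with a quotient of it, in terms of the relations. -/
theorem exists_map_ker_eq {rel rel' : Set (CurrentEnv L)}
    (h : ∀ u ∈ rel, u • gen rel' = 0) (N : Submodule (CurrentEnv L) (CyclicModule rel))
    (hN : ∀ u ∈ rel', u • gen rel ∈ N)
    (hN' : ∀ v ∈ N, ∃ u ∈ Submodule.span (CurrentEnv L) rel', u • gen rel = v) :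
    ∃ ψ : CyclicModule rel →ₗ[CurrentEnv L] CyclicModule rel',
      ψ (gen rel) = gen rel' ∧ Function.Surjective ψ ∧ LinearMap.ker ψ = N := by
  have hle : Submodule.span (CurrentEnv L) rel ≤ Submodule.span (CurrentEnv L) rel' := by
    rw [Submodule.span_le]
    intro u hu
    have := h u hu
    rwa [smul_gen_eq_mk, Submodule.Quotient.mk_eq_zero] at this
  refine ⟨Submodule.factor hle, rfl, Submodule.factor_surjective hle, ?_⟩
  have hmap : ∀ u, Submodule.factor hle (u • gen rel) = u • gen rel' := fun u => by
    rw [map_smul]; rfl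
  apply le_antisymm
  · intro v hv
    obtain ⟨u, rfl⟩ := Submodule.Quotient.mk_surjective _ v
    rw [LinearMap.mem_ker, ← smul_gen_eq_mk, hmap, smul_gen_eq_mk,
      Submodule.Quotient.mk_eq_zero] at hv
    have : Submodule.span (CurrentEnv L) rel' ≤
        N.comap (LinearMap.toSpanSingleton (CurrentEnv L) _ (gen rel)) := by
      rw [Submodule.span_le]
      exact fun u hu => hN u hu
    rw [← smul_gen_eq_mk]
    exact this hv
  · intro v hv
    obtain ⟨u, hu, rfl⟩ := hN' v hv
    rw [LinearMap.mem_ker, hmap, smul_gen_eq_mk, Submodule.Quotient.mk_eq_zero]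
    exact hu

end Cur

/-! ### Euclidean coordinates for simply laced roots -/

section Coordinates

variable {ι M N : Type*} [AddCommGroup M] [Module ℂ M] [AddCommGroup N] [Module ℂ N]
  {P : RootPairing ι ℂ M N} {b : P.Base} {n m : ℕ} {e : Fin n ≃ b.support}
  {a : Fin n → Fin m → ℤ}

/-- The root `i` and its coroot have the same integral coordinates `x` in the simple roots and
coroots, and `v = ∑ x k • a k`, where the vectors `a k` are thought of as the simple roots in a
Euclidean realization of the root system. -/
def HasVector (b : P.Base) (e : Fin n ≃ b.support) (a : Fin n → Fin m → ℤ) (i : ι)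
    (v : Fin m → ℤ) : Prop :=
  ∃ x : Fin n → ℤ, P.root i = ∑ k, x k • P.root (e k) ∧
    P.coroot i = ∑ k, x k • P.coroot (e k) ∧ v = ∑ k, x k • a k

theorem hasVector_simple (k : Fin n) : HasVector b e a (e k) (a k) := by
  refine ⟨Pi.single k 1, ?_, ?_, ?_⟩ <;>
  · rw [Finset.sum_eq_single k] <;> simp +contextual

theorem HasVector.pairing_eq {i j : ι} {v u : Fin m → ℤ}
    (ha : ∀ k l, P.pairing (e k) (e l) = ((a k ⬝ᵥ a l : ℤ) : ℂ))
    (hi : HasVector b e a i v) (hj : HasVector b e a j u) :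
    P.pairing i j = ((v ⬝ᵥ u : ℤ) : ℂ) := by
  obtain ⟨x, hx, -, rfl⟩ := hi
  obtain ⟨y, -, hy, rfl⟩ := hj
  rw [← RootPairing.root_coroot_eq_pairing, hx, hy, sum_dotProduct]
  simp only [map_sum, dotProduct_sum, LinearMap.sum_apply, map_zsmul, LinearMap.smul_apply,
    RootPairing.root_coroot_eq_pairing, ha, smul_dotProduct, dotProduct_smul]
  rw [Finset.sum_comm]
  push_cast
  simp [Finset.mul_sum]

/-- The Gram matrix is symmetric, so reflection and coreflection subtract the same multiple, and
equality of root and coroot coordinates persists. -/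
theorem HasVector.reflect {i j : ι} {v u : Fin m → ℤ}
    (ha : ∀ k l, P.pairing (e k) (e l) = ((a k ⬝ᵥ a l : ℤ) : ℂ))
    (hi : HasVector b e a i v) (hj : HasVector b e a j u) :
    HasVector b e a (P.reflectionPerm j i) (v - (v ⬝ᵥ u) • u) := by
  have h1 := hi.pairing_eq ha hj
  have h2 := hj.pairing_eq ha hi
  rw [dotProduct_comm] at h2
  obtain ⟨x, hx, hx', rfl⟩ := hi
  obtain ⟨y, hy, hy', rfl⟩ := hj
  generalize (∑ k, x k • a k) ⬝ᵥ ∑ k, y k • a k = c at *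
  refine ⟨x - c • y, ?_, ?_, ?_⟩
  · rw [RootPairing.root_reflectionPerm, RootPairing.reflection_apply_root, h1, Int.cast_smul_eq_zsmul,
      hx, hy]
    simp [sub_smul, Finset.smul_sum, mul_smul]
  · rw [RootPairing.coroot_reflectionPerm, RootPairing.coreflection_apply_coroot, h2,
      Int.cast_smul_eq_zsmul, hx', hy']
    simp [sub_smul, Finset.smul_sum, mul_smul]
  · simp [sub_smul, Finset.smul_sum, mul_smul]

theorem HasVector.apply_coroot {i : ι} {v : Fin m → ℤ} (hi : HasVector b e a i v)
    (φ : N →ₗ[ℂ] ℂ) (G : Fin m → ℤ)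
    (hφ : ∀ k, φ (P.coroot (e k)) = ((a k ⬝ᵥ G : ℤ) : ℂ)) :
    φ (P.coroot i) = ((v ⬝ᵥ G : ℤ) : ℂ) := by
  obtain ⟨x, -, hx, rfl⟩ := hi
  rw [hx, map_sum, sum_dotProduct]
  push_cast
  refine Finset.sum_congr rfl fun k _ => ?_
  rw [map_zsmul, hφ, smul_dotProduct]
  simp

theorem HasVector.exists_int {i : ι} {v : Fin m → ℤ} (hi : HasVector b e a i v)
    (φ : N →ₗ[ℂ] ℂ) (d : Fin n → ℤ) (hφ : ∀ k, φ (P.coroot (e k)) = (d k : ℂ)) :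
    ∃ d : ℤ, φ (P.coroot i) = d := by
  obtain ⟨x, -, hx, -⟩ := hi
  refine ⟨∑ k, x k * d k, ?_⟩
  rw [hx, map_sum]
  push_cast
  refine Finset.sum_congr rfl fun k _ => ?_
  rw [map_zsmul, hφ, zsmul_eq_mul]

theorem HasVector.height_eq {i : ι} {v : Fin m → ℤ} (hi : HasVector b e a i v)
    (η : Fin m → ℤ) (hη : ∀ k, a k ⬝ᵥ η = 1) : b.height i = v ⬝ᵥ η := by
  classical
  obtain ⟨x, hx, -, rfl⟩ := hi
  let f : ι → ℤ := fun j => if h : j ∈ b.support then x (e.symm ⟨j, h⟩) else 0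
  have hf : ∀ j : b.support, f j = x (e.symm j) := fun j => by simp [f]
  have h1 : P.root i = ∑ j ∈ b.support, f j • P.root j := by
    rw [hx, ← Finset.sum_coe_sort b.support (fun j => f j • P.root j), ← e.sum_comp]
    simp [hf]
  rw [RootPairing.Base.height_eq_sum h1, ← Finset.sum_coe_sort b.support f, ← e.sum_comp, sum_dotProduct]
  refine Finset.sum_congr rfl fun k _ => ?_
  rw [hf, Equiv.symm_apply_apply, smul_dotProduct, hη, smul_eq_mul, mul_one]

/-- Every root is reached from simple ones by reflections, and these preserve both the coordinates
and the square length. -/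
theorem exists_hasVector [Finite ι] [P.IsCrystallographic] [P.IsReduced]
    (ha : ∀ k l, P.pairing (e k) (e l) = ((a k ⬝ᵥ a l : ℤ) : ℂ)) (i : ι) :
    ∃ v, HasVector b e a i v ∧ v ⬝ᵥ v = 2 := by
  have hsimple : ∀ j ∈ b.support, ∃ v, HasVector b e a j v ∧ v ⬝ᵥ v = 2 := by
    intro j hj
    obtain ⟨k, hk⟩ := e.surjective ⟨j, hj⟩
    have hk' : (e k : ι) = j := by rw [hk]
    refine ⟨a k, hk' ▸ hasVector_simple k, ?_⟩
    have := ha k k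
    rw [RootPairing.pairing_same] at this
    exact_mod_cast this.symm
  have hrefl : ∀ i j v u, HasVector b e a i v → v ⬝ᵥ v = 2 → HasVector b e a j u → u ⬝ᵥ u = 2 →
      ∃ v, HasVector b e a (P.reflectionPerm j i) v ∧ v ⬝ᵥ v = 2 := by
    intro i j v u hi hv hj hu
    refine ⟨_, hi.reflect ha hj, ?_⟩
    simp only [sub_dotProduct, dotProduct_sub, smul_dotProduct, dotProduct_smul, hv, hu,
      dotProduct_comm u v, smul_eq_mul]
    ring
  refine b.induction_reflect i ?_ hsimple ?_
  · rintro i ⟨v, hi, hv⟩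
    exact hrefl i i v v hi hv hi hv
  · rintro i j ⟨v, hi, hv⟩ hj
    obtain ⟨u, hj, hu⟩ := hsimple j hj
    exact hrefl i j v u hi hv hj hu

theorem pairing_comm [Finite ι] [P.IsCrystallographic] [P.IsReduced]
    (ha : ∀ k l, P.pairing (e k) (e l) = ((a k ⬝ᵥ a l : ℤ) : ℂ)) (i j : ι) :
    P.pairing i j = P.pairing j i := by
  obtain ⟨v, hi, -⟩ := exists_hasVector ha i
  obtain ⟨u, hj, -⟩ := exists_hasVector ha j
  rw [hi.pairing_eq ha hj, hj.pairing_eq ha hi, dotProduct_comm]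

/-- Two roots with scalar product `-1` add up to a root. -/
theorem HasVector.exists_add {i j : ι} {v u : Fin m → ℤ}
    (ha : ∀ k l, P.pairing (e k) (e l) = ((a k ⬝ᵥ a l : ℤ) : ℂ))
    (hi : HasVector b e a i v) (hj : HasVector b e a j u) (h : v ⬝ᵥ u = -1) :
    ∃ k, P.root k = P.root i + P.root j ∧ HasVector b e a k (v + u) := by
  have := hi.reflect ha hj
  rw [h, neg_smul, one_smul, sub_neg_eq_add] at this
  refine ⟨_, ?_, this⟩
  rw [RootPairing.root_reflectionPerm, RootPairing.reflection_apply_root, hi.pairing_eq ha hj, h]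
  push_cast
  module

theorem HasVector.eq_of_eq [Finite ι] {i j : ι} {v : Fin m → ℤ}
    (ha : ∀ k l, P.pairing (e k) (e l) = ((a k ⬝ᵥ a l : ℤ) : ℂ))
    (hi : HasVector b e a i v) (hj : HasVector b e a j v) (hv : v ⬝ᵥ v = 2)
    [IsTorsionFree ℂ M] : i = j := by
  rw [← RootPairing.pairing_two_two_iff P, hi.pairing_eq ha hj, hj.pairing_eq ha hi, hv]
  simp

end Coordinates

/-! ### Sums of roots under a symmetric pairing -/

section SymmetricPairing

variable {ι M N : Type*} [AddCommGroup M] [Module ℂ M] [AddCommGroup N] [Module ℂ N]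
  {P : RootPairing ι ℂ M N}

theorem pairing_left_add {i j k : ι} (hk : P.root k = P.root i + P.root j) (l : ι) :
    P.pairing k l = P.pairing i l + P.pairing j l := by
  simp only [← RootPairing.root_coroot_eq_pairing, hk, map_add, LinearMap.add_apply]

variable (hsym : ∀ i j, P.pairing i j = P.pairing j i)
include hsym

/-- All roots have square length two, so `2 = 2 + 2 + 2 ⟨i, j⟩`. -/
theorem pairing_eq_neg_one {i j k : ι} (hk : P.root k = P.root i + P.root j) :
    P.pairing i j = -1 := by
  have h1 := pairing_left_add hk k
  have h2 := pairing_left_add hk i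
  have h3 := pairing_left_add hk j
  rw [RootPairing.pairing_same] at h1 h2 h3
  linear_combination (-h1 - h2 - h3 - hsym i k - hsym j k + hsym i j) / 2

theorem coroot_add {i j k : ι}
    (hk : P.root k = P.root i + P.root j) :
    P.coroot k = P.coroot i + P.coroot j := by
  have h1 := pairing_eq_neg_one hsym hk
  have : k = P.reflectionPerm j i := by
    apply P.root.injective
    rw [RootPairing.root_reflectionPerm, RootPairing.reflection_apply_root, h1, hk]
    module
  rw [this, RootPairing.coroot_reflectionPerm, RootPairing.coreflection_apply_coroot, hsym, h1]
  module

/-- Root strings have length at most two: `⟨k, j⟩ = -1 + 2 = 1`, while a sum that is a root requires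
`-1`. -/
theorem root_ne_add_add {i j k : ι} (hk : P.root k = P.root i + P.root j) (l : ι) :
    P.root l ≠ P.root k + P.root j := by
  intro hl
  have h1 := pairing_eq_neg_one hsym hk
  have h2 := pairing_eq_neg_one hsym hl
  rw [pairing_left_add hk, h1, RootPairing.pairing_same] at h2
  norm_num at h2

end SymmetricPairing

/-! ### Alternating sums and vectors of square length two -/

section Combinatorics

/-- Partial sums of a sequence with entries `0, 1, -1` whose nonzero entries alternate in sign. -/
theorem abs_sum_Ico_le_one_of_alternating {l m : ℕ → ℕ} (hlm : ∀ k, l k + m k ≤ 1)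
    (hl : ∀ i j, i < j → l i = 1 → l j = 1 → ∃ s, i < s ∧ s < j ∧ m s = 1)
    (hm : ∀ i j, i < j → m i = 1 → m j = 1 → ∃ s, i < s ∧ s < j ∧ l s = 1) (p q : ℕ) :
    |∑ k ∈ Finset.Ico p q, ((l k : ℤ) - m k)| ≤ 1 := by
  rcases le_total q p with hqp | hpq
  · simp [Finset.Ico_eq_empty_of_le hqp]
  -- The invariant for induction on `q` remembers the last nonzero entry: the sum is `0` or `1`
  -- after a `+1`, and `0` or `-1` after a `-1`.
  suffices H : (∑ k ∈ Finset.Ico p q, ((l k : ℤ) - m k) = 0 ∧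
        ∀ k, p ≤ k → k < q → l k = 0 ∧ m k = 0) ∨
      (∃ i, p ≤ i ∧ i < q ∧ l i = 1 ∧ (∀ k, i < k → k < q → l k = 0 ∧ m k = 0) ∧
        (∑ k ∈ Finset.Ico p q, ((l k : ℤ) - m k) = 0 ∨
          ∑ k ∈ Finset.Ico p q, ((l k : ℤ) - m k) = 1)) ∨
      (∃ i, p ≤ i ∧ i < q ∧ m i = 1 ∧ (∀ k, i < k → k < q → l k = 0 ∧ m k = 0) ∧
        (∑ k ∈ Finset.Ico p q, ((l k : ℤ) - m k) = 0 ∨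
          ∑ k ∈ Finset.Ico p q, ((l k : ℤ) - m k) = -1)) by
    rw [abs_le]
    rcases H with H | ⟨_, _, _, _, _, H⟩ | ⟨_, _, _, _, _, H⟩ <;> omega
  induction q, hpq using Nat.le_induction with
  | base => exact Or.inl ⟨by simp, fun k h1 h2 => absurd h1 (by omega)⟩
  | succ q hpq ih =>
    rw [Finset.sum_Ico_succ_top hpq]
    have hlq := hlm q
    have hext : ∀ i, (∀ k, i < k → k < q → l k = 0 ∧ m k = 0) → l q = 0 → m q = 0 →
        ∀ k, i < k → k < q + 1 → l k = 0 ∧ m k = 0 := by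
      intro i hi h1 h2 k hik hk
      rcases eq_or_lt_of_le (Nat.lt_succ_iff.mp hk) with rfl | hk
      · exact ⟨h1, h2⟩
      · exact hi k hik hk
    have hnil : ∀ k, q < k → k < q + 1 → l k = 0 ∧ m k = 0 := fun k h1 h2 => by omega
    rcases ih with ⟨H, hz⟩ | ⟨i, hpi, hiq, hi, hz, H⟩ | ⟨i, hpi, hiq, hi, hz, H⟩
    · by_cases h1 : l q = 1
      · exact Or.inr (Or.inl ⟨q, hpq, by omega, h1, hnil, by omega⟩)
      by_cases h2 : m q = 1
      · exact Or.inr (Or.inr ⟨q, hpq, by omega, h2, hnil, by omega⟩)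
      refine Or.inl ⟨by omega, fun k h3 h4 => ?_⟩
      rcases eq_or_lt_of_le (Nat.lt_succ_iff.mp h4) with rfl | h4
      · omega
      · exact hz k h3 h4
    · by_cases h1 : l q = 1
      · obtain ⟨s, hs, hs', hs1⟩ := hl i q hiq hi h1
        have := (hz s hs hs').2
        omega
      by_cases h2 : m q = 1
      · exact Or.inr (Or.inr ⟨q, hpq, by omega, h2, hnil, by omega⟩)
      exact Or.inr (Or.inl ⟨i, hpi, by omega, hi, hext i hz (by omega) (by omega), by omega⟩)
    · by_cases h1 : l q = 1
      · exact Or.inr (Or.inl ⟨q, hpq, by omega, h1, hnil, by omega⟩)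
      by_cases h2 : m q = 1
      · obtain ⟨s, hs, hs', hs1⟩ := hm i q hiq hi h2
        have := (hz s hs hs').1
        omega
      exact Or.inr (Or.inr ⟨i, hpi, by omega, hi, hext i hz (by omega) (by omega), by omega⟩)

/-- An integral vector of square length two is `± ε_p ± ε_q`. -/
theorem exists_eq_single_add_single {m : ℕ} {v : Fin m → ℤ} (hv : v ⬝ᵥ v = 2) :
    ∃ p q : Fin m, p < q ∧ ∃ s t : ℤ, (s = 1 ∨ s = -1) ∧ (t = 1 ∨ t = -1) ∧
      v = Pi.single p s + Pi.single q t := by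
  have hv' : ∑ i, v i * v i = 2 := hv
  have hunit : ∀ x : ℤ, x ≠ 0 → x * x ≤ 2 → x = 1 ∨ x = -1 := by
    intro x hx h
    have h1 : x ≤ 1 := by nlinarith
    have h2 : -1 ≤ x := by nlinarith
    omega
  have hnn : ∀ i, 0 ≤ v i * v i := fun i => mul_self_nonneg _
  obtain ⟨p, hp⟩ : ∃ p, v p ≠ 0 := by
    by_contra! h
    simp [h] at hv'
  have hsum := Finset.add_sum_erase Finset.univ (fun i => v i * v i) (Finset.mem_univ p)
  have hp1 := hunit _ hp (by
    have := Finset.sum_nonneg (s := Finset.univ.erase p) fun i _ => hnn i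
    omega)
  have hpp : v p * v p = 1 := by rcases hp1 with h | h <;> rw [h] <;> norm_num
  have hsum1 : ∑ i ∈ Finset.univ.erase p, v i * v i = 1 := by
    omega
  obtain ⟨q, hqm, hq⟩ : ∃ q ∈ Finset.univ.erase p, v q ≠ 0 := by
    by_contra! h
    rw [Finset.sum_eq_zero fun i hi => by rw [h i hi, zero_mul]] at hsum1
    omega
  have hqp : q ≠ p := Finset.ne_of_mem_erase hqm
  have hsum' := Finset.add_sum_erase _ (fun i => v i * v i) hqm
  have hnn' := Finset.sum_nonneg (s := (Finset.univ.erase p).erase q) fun i _ => hnn i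
  have hq1 := hunit _ hq (by
    omega)
  have hqq : v q * v q = 1 := by rcases hq1 with h | h <;> rw [h] <;> norm_num
  have hsum2 : ∑ i ∈ (Finset.univ.erase p).erase q, v i * v i = 0 := by
    omega
  have hz : ∀ i, i ≠ p → i ≠ q → v i = 0 := by
    intro i hip hiq
    have := (Finset.sum_eq_zero_iff_of_nonneg fun i _ => hnn i).mp hsum2 i (by simp [hip, hiq])
    exact mul_self_eq_zero.mp this
  have hsplit : v = Pi.single p (v p) + Pi.single q (v q) := by
    ext i
    by_cases hip : i = p
    · subst hip; simp [Pi.single_eq_of_ne hqp.symm]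
    by_cases hiq : i = q
    · subst hiq; simp [Pi.single_eq_of_ne hip]
    · simp [Pi.single_eq_of_ne hip, Pi.single_eq_of_ne hiq, hz i hip hiq]
  rcases lt_or_gt_of_ne hqp with h | h
  · exact ⟨q, p, h, v q, v p, hq1, hp1, by rw [add_comm]; exact hsplit⟩
  · exact ⟨p, q, h, v p, v q, hp1, hq1, hsplit⟩

end Combinatorics

/-! ### Type `A_n`: no exceptional roots -/

section TypeA

/-- The simple roots of type `A_n`, in the usual realization. -/
def simpleVectorA (n : ℕ) (k : Fin n) : Fin (n + 1) → ℤ :=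
  Pi.single k.castSucc 1 - Pi.single k.succ 1

theorem simpleVectorA_dotProduct {n : ℕ} (k : Fin n) (G : Fin (n + 1) → ℤ) :
    simpleVectorA n k ⬝ᵥ G = G k.castSucc - G k.succ := by
  simp [simpleVectorA, sub_dotProduct]

theorem cartanMatrix_A_eq {n : ℕ} (k l : Fin n) :
    CartanMatrix.A n k l = simpleVectorA n k ⬝ᵥ simpleVectorA n l := by
  rw [simpleVectorA_dotProduct]
  simp only [simpleVectorA, CartanMatrix.A, Matrix.of_apply, Pi.sub_apply, Pi.single_apply,
    Fin.ext_iff, Fin.val_castSucc, Fin.val_succ]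
  split_ifs <;> omega

variable {ι M N : Type*} [AddCommGroup M] [Module ℂ M] [AddCommGroup N] [Module ℂ N]
  {P : RootPairing ι ℂ M N} {b : P.Base} {n : ℕ} {e : Fin n ≃ b.support}

/-- A root is `±(ε_p - ε_q)`, and up to sign `φ` takes on its coroot the alternating sum of `l k - m
k` over `p ≤ k < q`. -/
theorem exists_abs_le_one_of_alternates_A [Finite ι] [P.IsCrystallographic] [P.IsReduced]
    (ha : ∀ k l, P.pairing (e k) (e l) = ((CartanMatrix.A n k l : ℤ) : ℂ))
    (φ : N →ₗ[ℂ] ℂ) {l m : Fin n → ℕ} (hlm : ∀ k, l k + m k ≤ 1)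
    (hl : Alternates l m .A) (hm : Alternates m l .A)
    (hφ : ∀ k, φ (P.coroot (e k)) = (((l k : ℤ) - m k : ℤ) : ℂ)) (i : ι) :
    ∃ d : ℤ, φ (P.coroot i) = d ∧ |d| ≤ 1 := by
  simp_rw [cartanMatrix_A_eq] at ha
  let L : ℕ → ℕ := fun k => if h : k < n then l ⟨k, h⟩ else 0
  let M : ℕ → ℕ := fun k => if h : k < n then m ⟨k, h⟩ else 0
  have hL : ∀ k : Fin n, L k = l k := fun k => by simp [L]
  have hM : ∀ k : Fin n, M k = m k := fun k => by simp [M]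
  have hL1 : ∀ k, L k = 1 → k < n := fun k hk => by
    by_contra h
    simp [L, h] at hk
  have hM1 : ∀ k, M k = 1 → k < n := fun k hk => by
    by_contra h
    simp [M, h] at hk
  have halt := abs_sum_Ico_le_one_of_alternating (l := L) (m := M)
    (fun k => by
      by_cases h : k < n
      · simpa [L, M, h] using hlm ⟨k, h⟩
      · simp [L, M, h])
    (fun i j hij hi hj => by
      obtain ⟨s, h1, h2, h3⟩ := hl ⟨i, hL1 i hi⟩ ⟨j, hL1 j hj⟩ hij
        (by rw [← hL]; exact hi) (by rw [← hL]; exact hj)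
      exact ⟨s, h1, h2, by rw [hM]; exact h3⟩)
    (fun i j hij hi hj => by
      obtain ⟨s, h1, h2, h3⟩ := hm ⟨i, hM1 i hi⟩ ⟨j, hM1 j hj⟩ hij
        (by rw [← hM]; exact hi) (by rw [← hM]; exact hj)
      exact ⟨s, h1, h2, by rw [hL]; exact h3⟩)
  let G : Fin (n + 1) → ℤ := fun i => ∑ k ∈ Finset.Ico (i : ℕ) n, ((L k : ℤ) - M k)
  have hG : ∀ k, simpleVectorA n k ⬝ᵥ G = (l k : ℤ) - m k := by
    intro k
    rw [simpleVectorA_dotProduct]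
    simp only [G, Fin.val_castSucc, Fin.val_succ]
    rw [Finset.sum_eq_sum_Ico_succ_bot k.2, hL, hM]
    ring
  obtain ⟨v, hv, hv2⟩ := exists_hasVector ha i
  refine ⟨_, hv.apply_coroot φ G fun k => by rw [hφ, hG], ?_⟩
  -- The coordinates of a root sum to zero, which forces opposite signs in `± ε_p ± ε_q`.
  have h0 : v ⬝ᵥ 1 = 0 := by
    obtain ⟨x, -, -, rfl⟩ := hv
    rw [sum_dotProduct]
    refine Finset.sum_eq_zero fun k _ => ?_
    rw [smul_dotProduct, simpleVectorA_dotProduct]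
    simp
  obtain ⟨p, q, hpq, s, t, hs, ht, rfl⟩ := exists_eq_single_add_single hv2
  have hpq' : G p - G q = ∑ k ∈ Finset.Ico (p : ℕ) q, ((L k : ℤ) - M k) := by
    simp only [G]
    rw [← Finset.sum_Ico_consecutive _ (Fin.lt_def.mp hpq).le (Nat.lt_succ_iff.mp q.2)]
    ring
  have hb := halt p q
  rw [← hpq', abs_le] at hb
  simp only [add_dotProduct, single_dotProduct, Pi.one_apply, mul_one] at h0
  simp only [add_dotProduct, single_dotProduct]
  rw [abs_le]
  rcases hs with rfl | rfl <;> rcases ht with rfl | rfl <;> omega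

end TypeA

/-! ### Type `D_n`: realization and existence of roots -/

section TypeD

/-- Alternating signs along a chain `0, …, N - 1, c`. -/
theorem abs_sum_add_le_one_of_alternating {L M : ℕ → ℕ} {N c : ℕ}
    (hLM : ∀ k, L k + M k ≤ 1)
    (hL : ∀ i j, i < j → j < N → L i = 1 → L j = 1 → ∃ s, i < s ∧ s < j ∧ M s = 1)
    (hM : ∀ i j, i < j → j < N → M i = 1 → M j = 1 → ∃ s, i < s ∧ s < j ∧ L s = 1)
    (hLc : ∀ i, i < N → L i = 1 → L c = 1 → ∃ s, i < s ∧ s < N ∧ M s = 1)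
    (hMc : ∀ i, i < N → M i = 1 → M c = 1 → ∃ s, i < s ∧ s < N ∧ L s = 1) :
    (∀ p q, q ≤ N → |∑ k ∈ Finset.Ico p q, ((L k : ℤ) - M k)| ≤ 1) ∧
    ∀ p, p ≤ N → |∑ k ∈ Finset.Ico p N, ((L k : ℤ) - M k) + (L c - M c)| ≤ 1 := by
  -- The chain becomes a sequence on `ℕ`: the entry at `c` is moved to position `N`, and zeros
  -- follow.
  have haux : ∀ L M : ℕ → ℕ,
      (∀ i j, i < j → j < N → L i = 1 → L j = 1 → ∃ s, i < s ∧ s < j ∧ M s = 1) →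
      (∀ i, i < N → L i = 1 → L c = 1 → ∃ s, i < s ∧ s < N ∧ M s = 1) →
      ∀ i j, i < j → (if i < N then L i else if i = N then L c else 0) = 1 →
      (if j < N then L j else if j = N then L c else 0) = 1 →
      ∃ s, i < s ∧ s < j ∧ (if s < N then M s else if s = N then M c else 0) = 1 := by
    intro L M h1 h2 i j hij hi hj
    by_cases hjN : j < N
    · rw [if_pos hjN] at hj
      rw [if_pos (by omega)] at hi
      obtain ⟨s, hs1, hs2, hs⟩ := h1 i j hij hjN hi hj
      exact ⟨s, hs1, hs2, by rw [if_pos (by omega), hs]⟩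
    by_cases hjN' : j = N
    · rw [if_neg hjN, if_pos hjN'] at hj
      rw [if_pos (by omega)] at hi
      obtain ⟨s, hs1, hs2, hs⟩ := h2 i (by omega) hi hj
      exact ⟨s, hs1, by omega, by rw [if_pos (by omega), hs]⟩
    · simp [hjN, hjN'] at hj
  have halt := abs_sum_Ico_le_one_of_alternating
    (l := fun k => if k < N then L k else if k = N then L c else 0)
    (m := fun k => if k < N then M k else if k = N then M c else 0)
    (fun k => by
      have := hLM k
      have := hLM c
      split_ifs <;> omega)
    (haux L M hL hLc) (haux M L hM hMc)
  have hsum : ∀ p q, q ≤ N → ∑ k ∈ Finset.Ico p q,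
      (((if k < N then L k else if k = N then L c else 0 : ℕ) : ℤ) -
        (if k < N then M k else if k = N then M c else 0 : ℕ)) =
      ∑ k ∈ Finset.Ico p q, ((L k : ℤ) - M k) := fun p q hq =>
    Finset.sum_congr rfl fun k hk => by
      have := (Finset.mem_Ico.mp hk).2
      rw [if_pos (by omega), if_pos (by omega)]
  refine ⟨fun p q hq => ?_, fun p hp => ?_⟩
  · rw [← hsum p q hq]
    exact halt p q
  · have := halt p (N + 1)
    rw [Finset.sum_Ico_succ_top hp, hsum p N le_rfl] at this
    simpa using this

/-- The simple roots of type `D_n`, in the usual realization. -/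
def simpleVectorD (n : ℕ) (k : Fin n) : Fin n → ℤ :=
  if h : (k : ℕ) + 1 < n then Pi.single k 1 - Pi.single ⟨k + 1, h⟩ 1
  else Pi.single ⟨n - 2, by have := k.2; omega⟩ 1 + Pi.single ⟨n - 1, by have := k.2; omega⟩ 1

theorem simpleVectorD_of_lt {n : ℕ} {k : Fin n} (h : (k : ℕ) + 1 < n) :
    simpleVectorD n k = Pi.single k 1 - Pi.single ⟨k + 1, h⟩ 1 := dif_pos h

theorem simpleVectorD_last {n : ℕ} {k : Fin n} (h : ¬ (k : ℕ) + 1 < n) :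
    simpleVectorD n k = Pi.single ⟨n - 2, by have := k.2; omega⟩ 1 +
      Pi.single ⟨n - 1, by have := k.2; omega⟩ 1 := dif_neg h

theorem cartanMatrix_D_eq {n : ℕ} (hn : 3 ≤ n) (k l : Fin n) :
    CartanMatrix.D n k l = simpleVectorD n k ⬝ᵥ simpleVectorD n l := by
  have hk := k.2
  have hl := l.2
  by_cases h : (k : ℕ) + 1 < n <;> by_cases h' : (l : ℕ) + 1 < n
  · rw [simpleVectorD_of_lt h, simpleVectorD_of_lt h']
    simp only [sub_dotProduct, single_dotProduct, CartanMatrix.D, Matrix.of_apply, Pi.sub_apply,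
      Pi.single_apply, Fin.ext_iff]
    split_ifs <;> omega
  · rw [simpleVectorD_of_lt h, simpleVectorD_last h']
    simp only [sub_dotProduct, single_dotProduct, CartanMatrix.D, Matrix.of_apply, Pi.add_apply,
      Pi.single_apply, Fin.ext_iff]
    split_ifs <;> omega
  · rw [simpleVectorD_last h, simpleVectorD_of_lt h']
    simp only [add_dotProduct, single_dotProduct, CartanMatrix.D, Matrix.of_apply, Pi.sub_apply,
      Pi.single_apply, Fin.ext_iff]
    split_ifs <;> omega
  · rw [simpleVectorD_last h, simpleVectorD_last h']
    simp only [add_dotProduct, single_dotProduct, CartanMatrix.D, Matrix.of_apply, Pi.add_apply,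
      Pi.single_apply, Fin.ext_iff]
    split_ifs <;> omega

variable {ι M N : Type*} [AddCommGroup M] [Module ℂ M] [AddCommGroup N] [Module ℂ N]
  {P : RootPairing ι ℂ M N} {b : P.Base} {n : ℕ} {e : Fin n ≃ b.support}

/-- The height of `ε_i` in type `D_n`. -/
def heightD (n : ℕ) (i : Fin n) : ℤ := n - 1 - i

theorem simpleVectorD_dotProduct_heightD (hn : 3 ≤ n) (k : Fin n) :
    simpleVectorD n k ⬝ᵥ heightD n = 1 := by
  have hk := k.2
  by_cases h : (k : ℕ) + 1 < n
  · rw [simpleVectorD_of_lt h]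
    simp [sub_dotProduct, heightD]
  · rw [simpleVectorD_last h]
    simp only [add_dotProduct, single_dotProduct, heightD]
    omega

section Existence

variable (ha : ∀ k l, P.pairing (e k) (e l) = ((simpleVectorD n k ⬝ᵥ simpleVectorD n l : ℤ) : ℂ))
include ha

theorem exists_hasVector_sub {p q : Fin n} (hpq : p < q) :
    ∃ i, HasVector b e (simpleVectorD n) i (Pi.single p 1 - Pi.single q 1) := by
  suffices ∀ r : ℕ, ∀ h : (p : ℕ) + r + 1 < n, ∃ i, HasVector b e (simpleVectorD n) i
      (Pi.single p 1 - Pi.single ⟨p + r + 1, h⟩ 1) by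
    have hpq' := Fin.lt_def.mp hpq
    obtain ⟨r, hr⟩ : ∃ r, (q : ℕ) = p + r + 1 := ⟨q - p - 1, by omega⟩
    have hq : q = ⟨p + r + 1, hr ▸ q.2⟩ := Fin.ext hr
    rw [hq]
    exact this r _
  intro r
  induction r with
  | zero =>
    intro h
    refine ⟨e p, ?_⟩
    have := hasVector_simple (b := b) (e := e) (a := simpleVectorD n) p
    rwa [simpleVectorD_of_lt h] at this
  | succ r ih =>
    intro h
    obtain ⟨i, hi⟩ := ih (by omega)
    have h1 := hasVector_simple (b := b) (e := e) (a := simpleVectorD n) ⟨p + r + 1, by omega⟩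
    rw [simpleVectorD_of_lt h] at h1
    obtain ⟨k, -, hk⟩ := hi.exists_add ha h1 (by
      simp only [sub_dotProduct, single_dotProduct, Pi.sub_apply, Pi.single_apply, Fin.ext_iff]
      split_ifs <;> omega)
    refine ⟨k, ?_⟩
    rw [sub_add_sub_cancel] at hk
    exact hk

/-- With indices from `0`, `ε_p + ε_q = (ε_p - ε_{n-1}) + (ε_{n-2} + ε_{n-1}) + (ε_q - ε_{n-2})`,
the last term being absent for `q = n - 2`; each partial sum is a root. -/
theorem exists_hasVector_add {p q : Fin n} (hn : 3 ≤ n) (hpq : p < q) (hq : (q : ℕ) + 1 < n) :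
    ∃ i, HasVector b e (simpleVectorD n) i (Pi.single p 1 + Pi.single q 1) := by
  have hpq' := Fin.lt_def.mp hpq
  have hlast := hasVector_simple (b := b) (e := e) (a := simpleVectorD n) ⟨n - 1, by omega⟩
  rw [simpleVectorD_last (by simp only; omega)] at hlast
  obtain ⟨i, hi⟩ := exists_hasVector_sub ha
    (show p < ⟨n - 1, by omega⟩ from Fin.lt_def.mpr (by simp only; omega))
  obtain ⟨j, -, hj⟩ := hi.exists_add ha hlast (by
    simp only [sub_dotProduct, single_dotProduct, Pi.add_apply, Pi.single_apply, Fin.ext_iff]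
    split_ifs <;> omega)
  by_cases hqn : (q : ℕ) = n - 2
  · refine ⟨j, ?_⟩
    have hq' : q = ⟨n - 2, by omega⟩ := Fin.ext hqn
    rw [hq']
    convert hj using 1
    abel
  · obtain ⟨k, hk⟩ := exists_hasVector_sub ha
      (show q < ⟨n - 2, by omega⟩ from Fin.lt_def.mpr (by simp only; omega))
    obtain ⟨l, -, hl⟩ := hj.exists_add ha hk (by
      simp only [sub_dotProduct, add_dotProduct, single_dotProduct, Pi.sub_apply, Pi.single_apply,
        Fin.ext_iff]
      split_ifs <;> omega)
    refine ⟨l, ?_⟩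
    convert hl using 1
    abel

end Existence

/-- `γ` is obtained from the positive root `β` by adding a positive root on whose coroot `φ`
vanishes. -/
def AddStep (b : P.Base) (φ : N →ₗ[ℂ] ℂ) (β γ : ι) : Prop :=
  ∃ δ, b.IsPos β ∧ b.IsPos δ ∧ φ (P.coroot δ) = 0 ∧ P.root γ = P.root β + P.root δ

/-- The added root is `δ = ε_p - ε_{p'}`, positive because `p < p'`, and `2 φ` is `G p - G p' = 0`
on its coroot. The factor `2` keeps `G` integral, as `φ` may be half-integral on `ε_i`. -/
theorem exists_addStep (ha : ∀ k l, P.pairing (e k) (e l) =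
      ((simpleVectorD n k ⬝ᵥ simpleVectorD n l : ℤ) : ℂ)) (hn : 3 ≤ n)
    (φ : N →ₗ[ℂ] ℂ) (G : Fin n → ℤ)
    (hφ : ∀ k, ((2 : ℂ) • φ) (P.coroot (e k)) = ((simpleVectorD n k ⬝ᵥ G : ℤ) : ℂ))
    {p p' r : Fin n} (hp : p < p') (hr : p ≠ r) (hr' : p' ≠ r) (hG : G p = G p') {β : ι}
    (hβ : HasVector b e (simpleVectorD n) β (Pi.single p' 1 + Pi.single r 1)) (hpos : b.IsPos β) :
    ∃ γ, HasVector b e (simpleVectorD n) γ (Pi.single p 1 + Pi.single r 1) ∧ b.IsPos γ ∧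
      AddStep b φ β γ := by
  obtain ⟨δ, hδ⟩ := exists_hasVector_sub ha hp
  obtain ⟨γ, hroot, hγ⟩ := hβ.exists_add ha hδ (by
    simp only [add_dotProduct, single_dotProduct, Pi.sub_apply, Pi.single_apply, hr.symm, hp.ne',
      hr'.symm]
    simp)
  have hδpos : b.IsPos δ := by
    rw [RootPairing.Base.isPos_iff, hδ.height_eq (heightD n) (simpleVectorD_dotProduct_heightD hn)]
    have := Fin.lt_def.mp hp
    simp only [sub_dotProduct, single_dotProduct, heightD]
    omega
  have hφδ : φ (P.coroot δ) = 0 := by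
    have h := hδ.apply_coroot ((2 : ℂ) • φ) G hφ
    simp only [sub_dotProduct, single_dotProduct, hG, LinearMap.smul_apply, smul_eq_mul] at h
    simpa using h
  refine ⟨γ, ?_, hpos.add hδpos hroot, δ, hpos, hδpos, hφδ, hroot⟩
  convert hγ using 1
  abel

end TypeD

/-! ### Type `D_n`: exceptional roots and the minimal one -/

section TypeDMain

variable {ι M N : Type*} [AddCommGroup M] [Module ℂ M] [AddCommGroup N] [Module ℂ N]
  {P : RootPairing ι ℂ M N} {b : P.Base} {n : ℕ} {e : Fin n ≃ b.support}

/-- Potential function for a pair of weights in type `D_n`: twice the value on `ε_i`. -/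
def potentialD (n : ℕ) (d : ℕ → ℤ) (i : Fin n) : ℤ :=
  if (i : ℕ) + 1 < n then 2 * (∑ k ∈ Finset.Ico (i : ℕ) (n - 2), d k) + d (n - 2) + d (n - 1)
  else d (n - 1) - d (n - 2)

theorem simpleVectorD_dotProduct_potentialD (hn : 3 ≤ n) (d : ℕ → ℤ) (k : Fin n) :
    simpleVectorD n k ⬝ᵥ potentialD n d = 2 * d k := by
  have hk := k.2
  by_cases h : (k : ℕ) + 1 < n
  · rw [simpleVectorD_of_lt h]
    simp only [sub_dotProduct, single_dotProduct, potentialD, if_pos h, one_mul]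
    by_cases h' : (k : ℕ) + 1 + 1 < n
    · rw [if_pos h', Finset.sum_eq_sum_Ico_succ_bot (show (k : ℕ) < n - 2 by omega)]
      ring
    · have : (k : ℕ) = n - 2 := by omega
      rw [if_neg h', this]
      simp
      ring
  · rw [simpleVectorD_last h]
    have : (k : ℕ) = n - 1 := by omega
    simp only [add_dotProduct, single_dotProduct, potentialD, one_mul, this]
    rw [if_pos (by omega), if_neg (by omega)]
    simp
    ring

/-- The bounds on the potential of an interlacing pair. -/
theorem potentialD_bounds (hn : 3 ≤ n) {l m : Fin n → ℕ} (hlm : ∀ k, l k + m k ≤ 1)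
    (hl : Alternates l m .D) (hm : Alternates m l .D) {d : ℕ → ℤ}
    (hd : ∀ k : Fin n, d k = (l k : ℤ) - m k) :
    (∀ i j : Fin n, (i : ℕ) + 1 < n → (j : ℕ) + 1 < n →
      |potentialD n d i - potentialD n d j| ≤ 2) ∧
    (∀ i j : Fin n, (i : ℕ) + 1 < n → (j : ℕ) + 1 = n →
      |potentialD n d i - potentialD n d j| ≤ 2 ∧ |potentialD n d i + potentialD n d j| ≤ 2) ∧
    (∀ i : Fin n, (i : ℕ) + 1 < n → |potentialD n d i| ≤ 2) := by
  let L : ℕ → ℕ := fun k => if h : k < n then l ⟨k, h⟩ else 0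
  let M : ℕ → ℕ := fun k => if h : k < n then m ⟨k, h⟩ else 0
  have hL : ∀ (k : ℕ) (h : k < n), L k = l ⟨k, h⟩ := fun k h => by simp [L, h]
  have hM : ∀ (k : ℕ) (h : k < n), M k = m ⟨k, h⟩ := fun k h => by simp [M, h]
  have hLM : ∀ k, L k + M k ≤ 1 := fun k => by
    by_cases h : k < n
    · rw [hL k h, hM k h]; exact hlm _
    · simp [L, M, h]
  have hdLM : ∀ k, k < n → d k = (L k : ℤ) - M k := fun k h => by
    rw [hL k h, hM k h]; exact hd ⟨k, h⟩
  have hfork : ∀ l m : Fin n → ℕ, Alternates l m .D → ∀ i j : Fin n, n ≤ (i : ℕ) + 2 →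
      n ≤ (j : ℕ) + 2 → l i = 1 → m j = 0 := by
    intro l m h i j hi hj hli
    have h1 := h.1 (Finset.sum_pos' (fun _ _ => Nat.zero_le _)
      ⟨i, by simpa using hi, by rw [hli]; exact Nat.one_pos⟩)
    exact (Finset.sum_eq_zero_iff.mp h1) j (by simpa using hj)
  have hchain : ∀ (l m : Fin n → ℕ) (L M : ℕ → ℕ), (∀ (k : ℕ) (h : k < n), L k = l ⟨k, h⟩) →
      (∀ (k : ℕ) (h : k < n), M k = m ⟨k, h⟩) → Alternates l m .D →
      (∀ i j, i < j → j < n - 2 → L i = 1 → L j = 1 → ∃ s, i < s ∧ s < j ∧ M s = 1) ∧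
      ∀ c, n - 2 ≤ c → c < n → ∀ i, i < n - 2 → L i = 1 → L c = 1 →
        ∃ s, i < s ∧ s < n - 2 ∧ M s = 1 := by
    intro l m L M hL hM h
    refine ⟨fun i j hij hj hLi hLj => ?_, fun c hc hcn i hi hLi hLc => ?_⟩
    · rw [hL i (by omega)] at hLi
      rw [hL j (by omega)] at hLj
      obtain ⟨s, h1, h2, h3⟩ := h.2 _ _ (Fin.lt_def.mpr hij) (by simp only; omega) hLi hLj
      exact ⟨s, h1, h2, by rw [hM s s.2]; exact h3⟩
    · rw [hL i (by omega)] at hLi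
      rw [hL c hcn] at hLc
      obtain ⟨s, h1, h2, h3⟩ := h.2 _ _ (Fin.lt_def.mpr (show i < c by omega))
        (by simp only; omega) hLi hLc
      have h1' : i < (s : ℕ) := h1
      have h2' : (s : ℕ) < c := h2
      -- The witness lies before the fork: a fork node carrying `l` excludes `m` from both fork
      -- nodes.
      refine ⟨s, h1, ?_, by rw [hM s s.2]; exact h3⟩
      by_contra hs
      have := hfork l m h ⟨c, hcn⟩ s (by simp only; omega) (by omega) hLc
      omega
  obtain ⟨hl1, hl2⟩ := hchain l m L M hL hM hl
  obtain ⟨hm1, hm2⟩ := hchain m l M L hM hL hm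
  obtain ⟨hint, hend⟩ := abs_sum_add_le_one_of_alternating hLM hl1 hm1
    (hl2 (n - 2) le_rfl (by omega)) (hm2 (n - 2) le_rfl (by omega))
  -- The diagram contains two chains, one through each fork node, and alternation holds along both.
  obtain ⟨-, hend'⟩ := abs_sum_add_le_one_of_alternating hLM hl1 hm1
    (hl2 (n - 1) (by omega) (by omega)) (hm2 (n - 1) (by omega) (by omega))
  have hsum : ∀ p q, q ≤ n - 2 →
      ∑ k ∈ Finset.Ico p q, d k = ∑ k ∈ Finset.Ico p q, ((L k : ℤ) - M k) := fun p q hq =>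
    Finset.sum_congr rfl fun k hk => hdLM k (by have := (Finset.mem_Ico.mp hk).2; omega)
  have hE : ∀ i : Fin n, (i : ℕ) + 1 < n →
      |∑ k ∈ Finset.Ico (i : ℕ) (n - 2), d k + d (n - 2)| ≤ 1 ∧
      |∑ k ∈ Finset.Ico (i : ℕ) (n - 2), d k + d (n - 1)| ≤ 1 := by
    intro i hi
    rw [hsum _ _ le_rfl, hdLM (n - 2) (by omega), hdLM (n - 1) (by omega)]
    exact ⟨hend i (by omega), hend' i (by omega)⟩
  refine ⟨fun i j hi hj => ?_, fun i j hi hj => ?_, fun i hi => ?_⟩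
  · simp only [potentialD, if_pos hi, if_pos hj]
    wlog hij : (i : ℕ) ≤ j generalizing i j
    · rw [abs_sub_comm]
      exact this j i hj hi (by omega)
    have h1 := hint i j (by omega)
    rw [← hsum _ _ (by omega)] at h1
    rw [← Finset.sum_Ico_consecutive d hij (show (j : ℕ) ≤ n - 2 by omega)]
    rw [abs_le] at h1 ⊢
    constructor <;> linarith [h1.1, h1.2]
  -- For `j` the last index, `G i - G j` and `G i + G j` are twice the sums along the chains ending
  -- at `n - 2` and `n - 1`.
  · simp only [potentialD, if_pos hi, if_neg (show ¬ (j : ℕ) + 1 < n by omega)]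
    obtain ⟨h1, h2⟩ := hE i hi
    rw [abs_le] at h1 h2 ⊢
    rw [abs_le]
    refine ⟨⟨?_, ?_⟩, ?_, ?_⟩ <;> linarith [h1.1, h1.2, h2.1, h2.2]
  · simp only [potentialD, if_pos hi]
    obtain ⟨h1, h2⟩ := hE i hi
    rw [abs_le] at h1 h2 ⊢
    constructor <;> linarith [h1.1, h1.2, h2.1, h2.2]

/-- An exceptional root needs `|G p + G q| = 4`, so both potentials are extremal with the same sign.
Since the height of `ε_i` decreases with `i`, the two largest extremal indices give the least
height. -/
theorem exists_minimal_of_alternates_D [Finite ι] [IsTorsionFree ℂ M] [P.IsCrystallographic]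
    [P.IsReduced] (hn : 3 ≤ n)
    (ha : ∀ k l, P.pairing (e k) (e l) = ((CartanMatrix.D n k l : ℤ) : ℂ))
    (φ : N →ₗ[ℂ] ℂ) {l m : Fin n → ℕ} (hlm : ∀ k, l k + m k ≤ 1)
    (hl : Alternates l m .D) (hm : Alternates m l .D)
    (hφ : ∀ k, φ (P.coroot (e k)) = (((l k : ℤ) - m k : ℤ) : ℂ)) :
    (∀ i, b.IsPos i → ∃ d : ℤ, φ (P.coroot i) = d ∧ |d| ≤ 1) ∨
    ∃ β, b.IsPos β ∧ ∀ γ, b.IsPos γ → (∃ d : ℤ, φ (P.coroot γ) = d ∧ |d| ≤ 1) ∨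
      ((γ ≠ β → b.height β < b.height γ) ∧ Relation.ReflTransGen (AddStep b φ) β γ) := by
  simp_rw [cartanMatrix_D_eq hn] at ha
  let d : ℕ → ℤ := fun k => if h : k < n then (l ⟨k, h⟩ : ℤ) - m ⟨k, h⟩ else 0
  have hd : ∀ k : Fin n, d k = (l k : ℤ) - m k := fun k => by simp [d]
  obtain ⟨hG1, hG2, hG3⟩ := potentialD_bounds hn hlm hl hm hd
  have hφG : ∀ k, ((2 : ℂ) • φ) (P.coroot (e k)) =
      ((simpleVectorD n k ⬝ᵥ potentialD n d : ℤ) : ℂ) := fun k => by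
    rw [simpleVectorD_dotProduct_potentialD hn, hd, LinearMap.smul_apply, hφ, smul_eq_mul]
    push_cast
    ring
  set G := potentialD n d with hGdef
  have hη := simpleVectorD_dotProduct_heightD (n := n) hn
  have hclass : ∀ γ, b.IsPos γ → (∃ d : ℤ, φ (P.coroot γ) = d ∧ |d| ≤ 1) ∨
      ∃ p q : Fin n, p < q ∧ (q : ℕ) + 1 < n ∧ |G p| = 2 ∧ G p = G q ∧
        HasVector b e (simpleVectorD n) γ (Pi.single p 1 + Pi.single q 1) := by
    intro γ hpos
    obtain ⟨v, hv, hv2⟩ := exists_hasVector ha γ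
    obtain ⟨c, hc⟩ := hv.exists_int φ _ hφ
    have hc2 : 2 * c = v ⬝ᵥ G := by
      have := hv.apply_coroot _ G hφG
      rw [LinearMap.smul_apply, hc, smul_eq_mul] at this
      exact_mod_cast this
    rw [RootPairing.Base.isPos_iff, hv.height_eq _ hη] at hpos
    obtain ⟨p, q, hpq, s, t, hs, ht, rfl⟩ := exists_eq_single_add_single hv2
    have hpq' := Fin.lt_def.mp hpq
    have hqn := q.2
    simp only [add_dotProduct, single_dotProduct, heightD] at hpos hc2
    -- The height `s (n - 1 - p) + t (n - 1 - q)` is positive and `p < q`, so the sign at `p` must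
    -- be `+`.
    obtain rfl : s = 1 := by
      rcases hs with rfl | rfl
      · rfl
      · rcases ht with rfl | rfl <;> omega
    by_cases hq : (q : ℕ) + 1 < n
    · have h1 := abs_le.mp (hG1 p q (by omega) hq)
      have h2 := abs_le.mp (hG3 p (by omega))
      have h3 := abs_le.mp (hG3 q hq)
      by_cases hcle : |c| ≤ 1
      · exact Or.inl ⟨c, hc, hcle⟩
      right
      rw [abs_le, not_and_or] at hcle
      rcases ht with rfl | rfl
      · refine ⟨p, q, hpq, hq, ?_, ?_, hv⟩
        · rcases hcle with h | h
          · rw [show G p = -2 by omega]; rfl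
          · rw [show G p = 2 by omega]; rfl
        · omega
      · omega
    · obtain ⟨h1, h2⟩ := hG2 p q (by omega) (by omega)
      rw [abs_le] at h1 h2
      refine Or.inl ⟨c, hc, abs_le.mpr ?_⟩
      rcases ht with rfl | rfl <;> omega
  let O : Finset (Fin n) := Finset.univ.filter fun i => (i : ℕ) + 1 < n ∧ |G i| = 2
  have hO : ∀ i, i ∈ O ↔ (i : ℕ) + 1 < n ∧ |G i| = 2 := fun i => by simp [O]
  by_cases hS : ∀ i, b.IsPos i → ∃ d : ℤ, φ (P.coroot i) = d ∧ |d| ≤ 1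
  · exact Or.inl hS
  right
  have hclassO : ∀ γ, b.IsPos γ → (∃ d : ℤ, φ (P.coroot γ) = d ∧ |d| ≤ 1) ∨
      ∃ p ∈ O, ∃ q ∈ O, p < q ∧
        HasVector b e (simpleVectorD n) γ (Pi.single p 1 + Pi.single q 1) := by
    intro γ hγ
    refine (hclass γ hγ).imp id ?_
    rintro ⟨p, q, hpq, hq, hp2, hpq2, hv⟩
    have := Fin.lt_def.mp hpq
    exact ⟨p, (hO p).mpr ⟨by omega, hp2⟩, q, (hO q).mpr ⟨hq, hpq2 ▸ hp2⟩, hpq, hv⟩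
  -- Opposite extremal values would differ by `4`, against the bound `2`.
  have hOeq : ∀ p ∈ O, ∀ q ∈ O, G p = G q := by
    intro p hp q hq
    rw [hO] at hp hq
    have h1 := abs_le.mp (hG1 p q hp.1 hq.1)
    rcases (abs_eq (by norm_num)).mp hp.2 with h | h <;>
      rcases (abs_eq (by norm_num)).mp hq.2 with h' | h' <;> omega
  obtain ⟨p₁, hp₁, q₁, hq₁, hpq₁⟩ : ∃ p ∈ O, ∃ q ∈ O, p < q := by
    push Not at hS
    obtain ⟨γ, hγ, h⟩ := hS
    rcases hclassO γ hγ with ⟨d, hd1, hd2⟩ | ⟨p, hp, q, hq, hpq, -⟩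
    · exact absurd (h d hd1) (not_lt.mpr hd2)
    · exact ⟨p, hp, q, hq, hpq⟩
  obtain ⟨q₀, hq₀, hq₀max⟩ := Finset.exists_max_image O id ⟨q₁, hq₁⟩
  obtain ⟨p₀, hp₀, hp₀max⟩ := Finset.exists_max_image (O.erase q₀) id
    ⟨p₁, Finset.mem_erase.mpr ⟨(hpq₁.trans_le (hq₀max q₁ hq₁)).ne, hp₁⟩⟩
  obtain ⟨hp₀ne, hp₀⟩ := Finset.mem_erase.mp hp₀
  have hlt₀ : p₀ < q₀ := lt_of_le_of_ne (hq₀max p₀ hp₀) hp₀ne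
  have hlt₀' := Fin.lt_def.mp hlt₀
  obtain ⟨β, hβ⟩ := exists_hasVector_add ha hn hlt₀ ((hO q₀).mp hq₀).1
  have hβpos : b.IsPos β := by
    rw [RootPairing.Base.isPos_iff, hβ.height_eq _ hη]
    have := q₀.2
    simp only [add_dotProduct, single_dotProduct, heightD]
    omega
  refine ⟨β, hβpos, fun γ hγpos => (hclassO γ hγpos).imp id ?_⟩
  rintro ⟨p, hp, q, hq, hpq, hγ⟩
  have hqle : q ≤ q₀ := hq₀max q hq
  have hple : p ≤ p₀ := hp₀max p (Finset.mem_erase.mpr ⟨(hpq.trans_le hqle).ne, hp⟩)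
  have hsq : ∀ {p q : Fin n}, p ≠ q →
      (Pi.single p 1 + Pi.single q 1 : Fin n → ℤ) ⬝ᵥ (Pi.single p 1 + Pi.single q 1) = 2 := by
    intro p q h
    simp [h, h.symm]
  constructor
  · intro hne
    rw [hβ.height_eq _ hη, hγ.height_eq _ hη]
    have h1 := Fin.le_def.mp hqle
    have h2 := Fin.le_def.mp hple
    have h3 : ¬ ((p : ℕ) = p₀ ∧ (q : ℕ) = q₀) := by
      rintro ⟨h3, h4⟩
      obtain rfl := Fin.ext h3
      obtain rfl := Fin.ext h4
      exact hne (hγ.eq_of_eq ha hβ (hsq hpq.ne))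
    simp only [add_dotProduct, single_dotProduct, heightD]
    omega
  -- The passage from `ε_{p₀} + ε_{q₀}` to `ε_p + ε_q` replaces one index at a time, through `ε_p +
  -- ε_{q₀}`. Either replacement may be void.
  · obtain ⟨β', hβ', hβ'pos, hstep⟩ : ∃ β', HasVector b e (simpleVectorD n) β'
        (Pi.single p 1 + Pi.single q₀ 1) ∧ b.IsPos β' ∧
        Relation.ReflTransGen (AddStep b φ) β β' := by
      rcases eq_or_lt_of_le hple with rfl | hlt
      · exact ⟨β, hβ, hβpos, .refl⟩
      · obtain ⟨β', h1, h2, h3⟩ := exists_addStep ha hn φ G hφG hlt (hlt.trans hlt₀).ne hlt₀.ne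
          (hOeq p hp p₀ hp₀) hβ hβpos
        exact ⟨β', h1, h2, .single h3⟩
    refine hstep.trans ?_
    rcases eq_or_lt_of_le hqle with rfl | hlt
    · rw [hγ.eq_of_eq ha hβ' (hsq hpq.ne)]
    · rw [add_comm] at hβ'
      obtain ⟨γ', h1, h2, h3⟩ := exists_addStep ha hn φ G hφG hlt hpq.ne' (hpq.trans hlt).ne'
        (hOeq q hq q₀ hq₀) hβ' hβ'pos
      rw [add_comm] at h1
      rw [hγ.eq_of_eq ha h1 (hsq hpq.ne)]
      exact .single h3

end TypeDMain

/-! ### Brackets of root vectors -/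

section RootVectors

variable {L : Type*} [LieRing L] [LieAlgebra ℂ L] [FiniteDimensional ℂ L]
  [LieAlgebra.IsKilling ℂ L] {H : LieSubalgebra ℂ L} [H.IsCartanSubalgebra]

theorem exists_eq_smul_of_mem_rootSpace_neg {α : H.root} {x y : L}
    (hx : x ∈ rootSpace H (-α.1)) (hy : y ∈ rootSpace H (-α.1)) (hy0 : y ≠ 0) :
    ∃ c : ℂ, x = c • y := by
  have hα : (-(α : LieModule.Weight ℂ H L)).IsNonZero :=
    LieModule.Weight.IsNonZero.neg (LieSubalgebra.isNonZero_coe_root α)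
  have h1 := finrank_rootSpace_eq_one _ hα
  rw [LieModule.Weight.coe_neg] at h1
  have h2 := (finrank_eq_one_iff_of_nonzero' (⟨y, hy⟩ : rootSpace H (-α.1))
    (by simpa [Subtype.ext_iff] using hy0)).mp h1 ⟨x, hx⟩
  obtain ⟨c, hc⟩ := h2
  exact ⟨c, by simpa using (congrArg Subtype.val hc).symm⟩

/-- An `𝔰𝔩₂`-triple attached to a root. -/
theorem exists_isSl2Triple_coroot (α : H.root) :
    ∃ e f : L, e ∈ rootSpace H α.1 ∧ f ∈ rootSpace H (-α.1) ∧
      IsSl2Triple ((rootSystem H).coroot α : L) e f := by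
  have hα := LieSubalgebra.isNonZero_coe_root α
  obtain ⟨h, e, f, ht, he, hf⟩ := exists_isSl2Triple_of_weight_isNonZero hα
  refine ⟨e, f, he, hf, ?_⟩
  have := ht.h_eq_coroot hα he hf
  rw [rootSystem_coroot_apply, ← this]
  exact ht

theorem lie_mem_rootSpace_neg {α β γ : H.root}
    (hγ : (rootSystem H).root γ = (rootSystem H).root α + (rootSystem H).root β) {x y : L}
    (hx : x ∈ rootSpace H (-α.1)) (hy : y ∈ rootSpace H (-β.1)) :
    ⁅x, y⁆ ∈ rootSpace H (-γ.1) := by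
  have h := lie_mem_genWeightSpace_of_mem_genWeightSpace hx hy
  have : (-⇑γ.1 : H → ℂ) = -⇑α.1 + -⇑β.1 := by
    ext t
    have := LinearMap.congr_fun hγ t
    simp only [rootSystem_root_apply, LinearMap.add_apply, LieModule.Weight.toLinear_apply] at this
    simp only [Pi.neg_apply, Pi.add_apply, this]
    ring
  rw [this]
  exact h

theorem lie_ne_zero_of_pairing_eq_neg_one {α β : H.root}
    (h : (rootSystem H).pairing β α = -1) {x y : L}
    (hx : x ∈ rootSpace H (-α.1)) (hy : y ∈ rootSpace H (-β.1)) (hx0 : x ≠ 0) (hy0 : y ≠ 0) :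
    ⁅x, y⁆ ≠ 0 := by
  intro h0
  obtain ⟨e, f, he, hf, ht⟩ := exists_isSl2Triple_coroot α
  obtain ⟨c, rfl⟩ := exists_eq_smul_of_mem_rootSpace_neg hf hx hx0
  -- If the bracket vanished, `y` would be a primitive vector of weight `-1` for the opposite
  -- triple, but such weights are natural numbers.
  have P : ht.symm.HasPrimitiveVectorWith y (-1 : ℂ) :=
    { ne_zero := hy0
      lie_h := by
        have := lie_eq_smul_of_mem_rootSpace hy ((rootSystem H).coroot α)
        rw [neg_lie]
        change -⁅(rootSystem H).coroot α, y⁆ = _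
        rw [this, Pi.neg_apply]
        have h' : (β.1 : H → ℂ) ((rootSystem H).coroot α) = -1 := h
        rw [h']
        simp
      lie_e := by rw [smul_lie, h0, smul_zero] }
  obtain ⟨n, hn⟩ := P.exists_nat
  have h1 : ((n + 1 : ℕ) : ℂ) = 0 := by
    push_cast
    rw [← hn]
    ring
  exact absurd (Nat.cast_eq_zero.mp h1) (by omega)

variable (hsym : ∀ i j : H.root, (rootSystem H).pairing i j = (rootSystem H).pairing j i)
include hsym

/-- A nonzero bracket would make `γ + β` a root or zero. `root_ne_add_add` excludes a root, and the
value `1 + 2` on the coroot of `β` excludes zero. -/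
theorem lie_eq_zero_of_root_eq_add {α β γ : H.root}
    (hγ : (rootSystem H).root γ = (rootSystem H).root α + (rootSystem H).root β) {x y : L}
    (hx : x ∈ rootSpace H (-γ.1)) (hy : y ∈ rootSpace H (-β.1)) : ⁅x, y⁆ = 0 := by
  by_contra h0
  have h := lie_mem_genWeightSpace_of_mem_genWeightSpace hx hy
  have hne : LieModule.genWeightSpace L (-⇑γ.1 + -⇑β.1 : H → ℂ) ≠ ⊥ := by
    intro hbot
    rw [hbot] at h
    exact h0 ((LieSubmodule.mem_bot _).mp h)
  let χ : LieModule.Weight ℂ H L := ⟨_, hne⟩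
  have hχ : ∀ t : H, (-χ) t = γ.1 t + β.1 t := fun t => by
    rw [LieModule.Weight.coe_neg]
    change -(-γ.1 t + -β.1 t) = _
    ring
  by_cases hz : (-χ).IsNonZero
  · let δ : H.root := ⟨-χ, by simpa [LieSubalgebra.root] using hz⟩
    refine root_ne_add_add hsym hγ δ ?_
    ext t
    exact hχ t
  · rw [LieModule.Weight.IsNonZero, not_not] at hz
    have h1 := hχ ((rootSystem H).coroot β)
    rw [hz] at h1
    have h2 := pairing_left_add hγ β
    rw [pairing_eq_neg_one hsym hγ, RootPairing.pairing_same] at h2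
    have h3 : γ.1 ((rootSystem H).coroot β) = -1 + 2 := h2
    have h4 : β.1 ((rootSystem H).coroot β) = 2 := RootPairing.pairing_same (rootSystem H) β
    rw [h3, h4] at h1
    norm_num at h1

end RootVectors

/-! ### Consequences of the local Weyl relations -/

section LocalWeyl

variable {L : Type*} [LieRing L] [LieAlgebra ℂ L] [FiniteDimensional ℂ L]
  [LieAlgebra.IsKilling ℂ L] {H : LieSubalgebra ℂ L} [H.IsCartanSubalgebra]
  {b : (rootSystem H).Base} {lam : Dual ℂ H}
  {M : Type*} [AddCommGroup M] [Module (CurrentEnv L) M] {w : M}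

omit [FiniteDimensional ℂ L] [LieAlgebra.IsKilling ℂ L] in
theorem cur_smul_pow_smul_eq_zero {y : L} {r N : ℕ} (h : cur y r ^ N • w = 0) (c : ℂ) :
    cur (c • y) r ^ N • w = 0 := by
  rw [cur_smul, smul_pow, Algebra.smul_def, mul_smul, h, smul_zero]

variable (hw : ∀ u ∈ localWeylRel b lam, u • w = 0)
include hw

theorem cur_smul_eq_zero_of_pos {α : H.root} (hα : b.IsPos α) {x : L}
    (hx : x ∈ rootSpace H α.1) (r : ℕ) : cur x r • w = 0 :=
  hw _ (Or.inl (Or.inl ⟨α, hα, x, hx, r, rfl⟩))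

theorem cur_cartan_smul (h : H) (r : ℕ) :
    cur (h : L) r • w = algebraMap ℂ (CurrentEnv L) (if r = 0 then lam h else 0) • w := by
  have := hw _ (Or.inl (Or.inr ⟨h, r, rfl⟩))
  rwa [sub_smul, sub_eq_zero] at this

theorem cur_cartan_smul_eq_zero (h : H) (r : ℕ) : cur (h : L) (r + 1) • w = 0 := by
  rw [cur_cartan_smul hw, if_neg (Nat.succ_ne_zero r), map_zero, zero_smul]

/-- Induction on adding simple roots. When `k = i + j`, the negative root vectors of `i`, `j` and
their bracket span a Heisenberg algebra, so nilpotency passes to the bracket, which spans the root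
space of `-k`. -/
theorem exists_cur_pow_smul_eq_zero
    (hsym : ∀ i j : H.root, (rootSystem H).pairing i j = (rootSystem H).pairing j i)
    {α : H.root} (hα : b.IsPos α) {y : L} (hy : y ∈ rootSpace H (-α.1)) :
    ∃ N : ℕ, cur y 0 ^ N • w = 0 := by
  have key : ∀ y ∈ rootSpace H (-α.1), ∃ N : ℕ, cur y 0 ^ N • w = 0 := by
    refine hα.induction_on_add (p := fun α => ∀ y ∈ rootSpace H (-α.1),
      ∃ N : ℕ, cur y 0 ^ N • w = 0) ?_ ?_
    · intro i hi y hy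
      exact ⟨_, hw _ (Or.inr ⟨i, hi, y, hy, rfl⟩)⟩
    · intro i j k hk ih hj y hy
      obtain ⟨_, yi, -, hyi, hti⟩ := exists_isSl2Triple_coroot i
      obtain ⟨_, yj, -, hyj, htj⟩ := exists_isSl2Triple_coroot j
      obtain ⟨a, ha⟩ := ih yi hyi
      have hc := hw _ (Or.inr ⟨j, hj, yj, hyj, rfl⟩)
      have hz := lie_mem_rootSpace_neg hk hyi hyj
      have hpair : (rootSystem H).pairing j i = -1 := by
        rw [hsym]; exact pairing_eq_neg_one hsym hk
      have hz0 := lie_ne_zero_of_pairing_eq_neg_one hpair hyi hyj hti.f_ne_zero htj.f_ne_zero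
      obtain ⟨c, rfl⟩ := exists_eq_smul_of_mem_rootSpace_neg hy hz hz0
      obtain ⟨N, hN⟩ := exists_pow_smul_eq_zero (cur_mul_cur yi yj 0 0)
        (commute_cur (lie_eq_zero_of_root_eq_add hsym (hk.trans (add_comm _ _)) hz hyi) _ _)
        (commute_cur (lie_eq_zero_of_root_eq_add hsym hk hz hyj) _ _) a _ hc ha
      exact ⟨N, cur_smul_pow_smul_eq_zero hN c⟩
  exact key y hy

/-- The relations `(x_α⁻ ⊗ 1) ^ (λ(h_α) + 1) w = 0` for all positive roots. -/
theorem cur_pow_ev_succ_smul_eq_zero (hlam : IsDominant b lam)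
    (hsym : ∀ i j : H.root, (rootSystem H).pairing i j = (rootSystem H).pairing j i)
    {α : H.root} (hα : b.IsPos α) {y : L} (hy : y ∈ rootSpace H (-α.1)) :
    cur y 0 ^ (ev lam α + 1) • w = 0 := by
  obtain ⟨e, f, he, hf, ht⟩ := exists_isSl2Triple_coroot α
  obtain ⟨c, rfl⟩ := exists_eq_smul_of_mem_rootSpace_neg hy hf ht.f_ne_zero
  obtain ⟨N, hN⟩ := exists_cur_pow_smul_eq_zero hw hsym hα hf
  refine cur_smul_pow_smul_eq_zero ?_ c
  have h1 := cur_mul_cur e f 0 0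
  have h2 := cur_mul_cur ((rootSystem H).coroot α : L) f 0 0
  rw [ht.lie_e_f] at h1
  rw [ht.lie_h_f_nsmul, cur_neg, two_smul, ← two_smul ℂ, cur_smul, ← sub_eq_add_neg] at h2
  refine pow_succ_smul_eq_zero h1 (h2.trans ?_) (cur_smul_eq_zero_of_pos hw hα he 0) ?_ hN
  · rw [two_smul, two_mul]
  · rw [cur_cartan_smul hw, if_pos rfl, ← coe_ev hlam hα, map_natCast]

/-- For `k > s`, the commutator of `h_α ⊗ t ^ (k - s)` with `y ⊗ t ^ s` is `-2 y ⊗ t ^ k`, and both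
elements kill `w`. -/
theorem cur_smul_eq_zero_of_le {α : H.root} {y : L} (hy : y ∈ rootSpace H (-α.1)) {s : ℕ}
    (hs : cur y s • w = 0) {k : ℕ} (hk : s ≤ k) : cur y k • w = 0 := by
  rcases eq_or_lt_of_le hk with rfl | hk
  · exact hs
  obtain ⟨r, rfl⟩ : ∃ r, k = r + 1 + s := ⟨k - s - 1, by omega⟩
  have h1 := cur_mul_cur ((rootSystem H).coroot α : L) y (r + 1) s
  have h2 : ⁅((rootSystem H).coroot α : L), y⁆ = (-2 : ℂ) • y := by
    have := lie_eq_smul_of_mem_rootSpace hy ((rootSystem H).coroot α)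
    change ⁅(rootSystem H).coroot α, y⁆ = _
    rw [this, Pi.neg_apply]
    have h' : (α.1 : H → ℂ) ((rootSystem H).coroot α) = 2 := RootPairing.pairing_same (rootSystem H) α
    rw [h']
  rw [h2, cur_smul] at h1
  have h3 := congrArg (· • w) h1
  simp only [mul_smul, add_smul, hs, cur_cartan_smul_eq_zero hw, smul_zero, zero_add,
    Algebra.smul_def] at h3
  refine eq_zero_of_intCast_smul (A := CurrentEnv L) (k := -2) (by norm_num) ?_
  rw [← map_intCast (algebraMap ℂ (CurrentEnv L))]
  simpa using h3.symm

/-- This turns the vanishing of `x_α⁻ ⊗ t ^ (d + 1)` into a power relation one degree lower, by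
Garland's argument for the `𝔰𝔩₂[t]` of `α` with `E = x_α⁺ ⊗ t`. -/
theorem cur_pow_smul_eq_zero (hlam : IsDominant b lam)
    (hsym : ∀ i j : H.root, (rootSystem H).pairing i j = (rootSystem H).pairing j i)
    {α : H.root} (hα : b.IsPos α) {y : L} (hy : y ∈ rootSpace H (-α.1)) {d r : ℕ}
    (hd : ∀ y ∈ rootSpace H (-α.1), cur y (d + 1) • w = 0) (hr : ev lam α < r * (d + 1)) :
    cur y d ^ r • w = 0 := by
  obtain ⟨e, f, he, hf, ht⟩ := exists_isSl2Triple_coroot α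
  obtain ⟨c, rfl⟩ := exists_eq_smul_of_mem_rootSpace_neg hy hf ht.f_ne_zero
  refine cur_smul_pow_smul_eq_zero ?_ c
  refine pow_smul_eq_zero_of_garland (E := cur e 1) (Y := cur f)
    (K := cur ((rootSystem H).coroot α : L)) (fun i j => commute_cur (lie_self f) i j)
    (fun j => ?_) (fun k j => ?_) (cur_smul_eq_zero_of_pos hw hα he 1)
    (cur_cartan_smul_eq_zero hw _) (cur_pow_ev_succ_smul_eq_zero hw hlam hsym hα hf)
    (fun k hk => cur_smul_eq_zero_of_le hw hf (hd f hf) hk) hr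
  · rw [cur_mul_cur, ht.lie_e_f, add_comm 1 j]
  · rw [cur_mul_cur, ht.lie_h_f_nsmul, cur_neg, two_smul, ← two_smul ℂ, cur_smul,
      ← sub_eq_add_neg, two_smul, two_mul, show k + 1 + j = j + k + 1 by ring]

-- The root space of `-γ` is spanned by a bracket of root vectors for `-δ` and `-β`. Since the `δ`
-- factor kills `w`, only its product with an element of `N` survives.
omit hw in
theorem cur_smul_mem_of_root_eq_add
    (hsym : ∀ i j : H.root, (rootSystem H).pairing i j = (rootSystem H).pairing j i)
    {β γ δ : H.root}
    (hγ : (rootSystem H).root γ = (rootSystem H).root β + (rootSystem H).root δ)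
    (N : Submodule (CurrentEnv L) M) {s k : ℕ}
    (hδ : ∀ y ∈ rootSpace H (-δ.1), cur y k • w = 0)
    (hβ : ∀ y ∈ rootSpace H (-β.1), cur y s • w ∈ N) {y : L} (hy : y ∈ rootSpace H (-γ.1)) :
    cur y (k + s) • w ∈ N := by
  obtain ⟨_, yβ, -, hyβ, htβ⟩ := exists_isSl2Triple_coroot β
  obtain ⟨_, yδ, -, hyδ, htδ⟩ := exists_isSl2Triple_coroot δ
  have hz := lie_mem_rootSpace_neg (hγ.trans (add_comm _ _)) hyδ hyβ
  have hz0 := lie_ne_zero_of_pairing_eq_neg_one (pairing_eq_neg_one hsym hγ) hyδ hyβ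
    htδ.f_ne_zero htβ.f_ne_zero
  obtain ⟨c, rfl⟩ := exists_eq_smul_of_mem_rootSpace_neg hy hz hz0
  have h1 := congrArg (· • w) (cur_mul_cur yδ yβ k s)
  simp only [mul_smul, add_smul, hδ yδ hyδ, smul_zero, zero_add] at h1
  rw [cur_smul, Algebra.smul_def, mul_smul, ← h1]
  exact N.smul_mem _ (N.smul_mem _ (hβ yβ hyβ))

end LocalWeyl

/-! ### Comparison of `V(λ, μ)` with the level two Demazure module -/

section Comparison

theorem natCeil_half (k : ℕ) : ⌈(k : ℚ) / 2⌉₊ = (k + 1) / 2 := by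
  apply le_antisymm
  · rw [Nat.ceil_le, div_le_iff₀ (by norm_num)]
    have : k ≤ (k + 1) / 2 * 2 := by omega
    exact_mod_cast this
  · have h := Nat.le_ceil ((k : ℚ) / 2)
    rw [div_le_iff₀ (by norm_num)] at h
    have h' : k ≤ ⌈(k : ℚ) / 2⌉₊ * 2 := by exact_mod_cast h
    omega

variable {L : Type*} [LieRing L] [LieAlgebra ℂ L] [FiniteDimensional ℂ L]
  [LieAlgebra.IsKilling ℂ L] {H : LieSubalgebra ℂ L} [H.IsCartanSubalgebra]
  {b : (rootSystem H).Base} {lam mu : Dual ℂ H}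

theorem IsDominant.add (h₁ : IsDominant b lam) (h₂ : IsDominant b mu) :
    IsDominant b (lam + mu) := by
  intro i hi
  obtain ⟨k, hk⟩ := h₁ i hi
  obtain ⟨l, hl⟩ := h₂ i hi
  exact ⟨k + l, by rw [LinearMap.add_apply, hk, hl]; push_cast; rfl⟩

theorem ev_add (h₁ : IsDominant b lam) (h₂ : IsDominant b mu) {α : H.root} (hα : b.IsPos α) :
    ev (lam + mu) α = ev lam α + ev mu α := by
  have h := coe_ev (h₁.add h₂) hα
  rw [LinearMap.add_apply, ← coe_ev h₁ hα, ← coe_ev h₂ hα] at h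
  exact_mod_cast h

theorem sub_apply_coroot (h₁ : IsDominant b lam) (h₂ : IsDominant b mu) {α : H.root}
    (hα : b.IsPos α) :
    (lam - mu) ((rootSystem H).coroot α) = (((ev lam α : ℤ) - ev mu α : ℤ) : ℂ) := by
  rw [LinearMap.sub_apply, ← coe_ev h₁ hα, ← coe_ev h₂ hα]
  push_cast
  rfl

theorem ev_eq_add_of_root_eq_add
    (hsym : ∀ i j : H.root, (rootSystem H).pairing i j = (rootSystem H).pairing j i)
    (h : IsDominant b lam) {α β γ : H.root} (hα : b.IsPos α) (hβ : b.IsPos β)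
    (hγ : (rootSystem H).root γ = (rootSystem H).root α + (rootSystem H).root β) :
    ev lam γ = ev lam α + ev lam β := by
  have h1 := coe_ev h (hα.add hβ hγ)
  rw [coroot_add hsym hγ, map_add, ← coe_ev h hα, ← coe_ev h hβ] at h1
  exact_mod_cast h1

/-- The Demazure module of level two satisfies the relations of `V(λ, μ)`. -/
theorem smul_gen_demazure_eq_zero (h₁ : IsDominant b lam) (h₂ : IsDominant b mu) :
    ∀ u ∈ vRel b lam mu, u • gen (demazureRel b 2 (lam + mu)) = 0 := by
  have hw : ∀ u ∈ localWeylRel b (lam + mu), u • gen (demazureRel b 2 (lam + mu)) = 0 :=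
    fun u hu => smul_gen_eq_zero (Or.inl hu)
  rintro u (hu | ⟨α, hα, y, hy, rfl⟩)
  · exact hw u hu
  · have hev := ev_add h₁ h₂ hα
    refine cur_smul_eq_zero_of_le hw hy (s := (ev (lam + mu) α + 1) / 2) ?_ ?_
    -- The integer `m` is `2` for even `(λ + μ)(h_α)` and `1` for odd.
    · exact smul_gen_eq_zero (Or.inr ⟨α, hα, y, hy, _,
        ev (lam + mu) α + 2 - 2 * ((ev (lam + mu) α + 1) / 2), by omega, by omega, by omega,
        Or.inl rfl⟩)
    · rw [hev]
      rcases le_total (ev lam α) (ev mu α) with h | h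
      · rw [max_eq_right h]; omega
      · rw [max_eq_left h]; omega

/-- A submodule of `V(λ, μ)` contains the relations of the level two Demazure module as soon as it
contains those which are linear in the root vectors. -/
theorem smul_gen_mem_of_mem_demazureRel
    (hsym : ∀ i j : H.root, (rootSystem H).pairing i j = (rootSystem H).pairing j i)
    (h₁ : IsDominant b lam) (h₂ : IsDominant b mu) (N : Submodule (CurrentEnv L) (V b lam mu))
    (hN : ∀ α : H.root, b.IsPos α → ∀ y ∈ rootSpace H (-α.1),
      cur y ((ev (lam + mu) α + 1) / 2) • gen (vRel b lam mu) ∈ N) :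
    ∀ u ∈ demazureRel b 2 (lam + mu), u • gen (vRel b lam mu) ∈ N := by
  have hw : ∀ u ∈ localWeylRel b (lam + mu), u • gen (vRel b lam mu) = 0 :=
    fun u hu => smul_gen_eq_zero (Or.inl hu)
  -- Modulo `N` the linear relations hold exactly, so the power relations can be derived in the
  -- quotient.
  have hw' : ∀ u ∈ localWeylRel b (lam + mu), u • N.mkQ (gen (vRel b lam mu)) = 0 :=
    fun u hu => by rw [← map_smul, hw u hu, map_zero]
  rintro u (hu | ⟨α, hα, y, hy, s, m, hm, hm', hsm, rfl | ⟨hs, rfl⟩⟩)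
  · rw [hw u hu]
    exact N.zero_mem
  · have : s = (ev (lam + mu) α + 1) / 2 := by omega
    rw [this]
    exact hN α hα y hy
  · rw [← Submodule.ker_mkQ N, LinearMap.mem_ker, map_smul]
    refine cur_pow_smul_eq_zero hw' (h₁.add h₂) hsym hα hy (fun y hy => ?_) ?_
    · rw [← map_smul, ← LinearMap.mem_ker, Submodule.ker_mkQ,
        show s - 1 + 1 = (ev (lam + mu) α + 1) / 2 by omega]
      exact hN α hα y hy
    · rw [Nat.sub_add_cancel hs]
      obtain ⟨r, rfl⟩ : ∃ r, s = r + 1 := ⟨s - 1, by omega⟩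
      -- The bound is `2 r + m < (m + 1)(r + 1)`, whose sides differ by `r (m - 1) + 1`; here `m ≥
      -- 1`.
      nlinarith

/-- Two natural numbers differing by at most one have maximum equal to half their sum, rounded up.
-/
theorem cur_smul_gen_eq_zero_of_abs_le_one (h₁ : IsDominant b lam) (h₂ : IsDominant b mu)
    {α : H.root} (hα : b.IsPos α)
    (h : ∃ d : ℤ, (lam - mu) ((rootSystem H).coroot α) = d ∧ |d| ≤ 1) {y : L}
    (hy : y ∈ rootSpace H (-α.1)) :
    cur y ((ev (lam + mu) α + 1) / 2) • gen (vRel b lam mu) = 0 := by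
  obtain ⟨d, hd, hd1⟩ := h
  rw [sub_apply_coroot h₁ h₂ hα] at hd
  have hd' : (ev lam α : ℤ) - ev mu α = d := by exact_mod_cast hd
  rw [abs_le] at hd1
  have : (ev (lam + mu) α + 1) / 2 = max (ev lam α) (ev mu α) := by
    rw [ev_add h₁ h₂ hα]
    rcases le_total (ev lam α) (ev mu α) with h | h
    · rw [max_eq_right h]; omega
    · rw [max_eq_left h]; omega
  rw [this]
  exact smul_gen_eq_zero (Or.inr ⟨α, hα, y, hy, rfl⟩)

/-- Since `λ(h_δ) = μ(h_δ)`, the exponent at `β + δ` is that at `β` plus `λ(h_δ)`, and `x_δ⁻ ⊗ t ^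
λ(h_δ)` kills the generator. -/
theorem cur_smul_gen_mem_of_reflTransGen
    (hsym : ∀ i j : H.root, (rootSystem H).pairing i j = (rootSystem H).pairing j i)
    (h₁ : IsDominant b lam) (h₂ : IsDominant b mu) (N : Submodule (CurrentEnv L) (V b lam mu))
    {β γ : H.root} (h : Relation.ReflTransGen (AddStep b (lam - mu)) β γ)
    (hN : ∀ y ∈ rootSpace H (-β.1),
      cur y ((ev (lam + mu) β + 1) / 2) • gen (vRel b lam mu) ∈ N) :
    ∀ y ∈ rootSpace H (-γ.1),
      cur y ((ev (lam + mu) γ + 1) / 2) • gen (vRel b lam mu) ∈ N := by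
  induction h with
  | refl => exact hN
  | tail _ hstep ih =>
    obtain ⟨δ, hβ, hδ, hδ0, hroot⟩ := hstep
    intro y hy
    rw [sub_apply_coroot h₁ h₂ hδ] at hδ0
    have hδ0' : (ev lam δ : ℤ) - ev mu δ = 0 := by exact_mod_cast hδ0
    rw [ev_eq_add_of_root_eq_add hsym (h₁.add h₂) hβ hδ hroot]
    have hev := ev_add h₁ h₂ hδ
    have := cur_smul_mem_of_root_eq_add hsym hroot N (k := ev lam δ)
      (fun y hy => smul_gen_eq_zero (Or.inr ⟨δ, hδ, y, hy, by
        rw [max_eq_left (by omega)]⟩)) ih hy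
    convert this using 3
    omega

theorem exists_equiv_of_forall_eq_zero
    (hsym : ∀ i j : H.root, (rootSystem H).pairing i j = (rootSystem H).pairing j i)
    (h₁ : IsDominant b lam) (h₂ : IsDominant b mu)
    (h : ∀ α : H.root, b.IsPos α → ∀ y ∈ rootSpace H (-α.1),
      cur y ((ev (lam + mu) α + 1) / 2) • gen (vRel b lam mu) = 0) :
    ∃ f : V b lam mu ≃ₗ[CurrentEnv L] Demazure b 2 (lam + mu),
      IsGraded f.toLinearMap ∧ IsGraded f.symm.toLinearMap ∧ f (gen _) = gen _ := by
  obtain ⟨ψ, hψ, hsurj, hker⟩ := exists_map_ker_eq (smul_gen_demazure_eq_zero h₁ h₂) ⊥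
    (smul_gen_mem_of_mem_demazureRel hsym h₁ h₂ ⊥ fun α hα y hy =>
      (Submodule.mem_bot _).mpr (h α hα y hy))
    (fun v hv => ⟨0, Submodule.zero_mem _, by rw [zero_smul, (Submodule.mem_bot _).mp hv]⟩)
  let f := LinearEquiv.ofBijective ψ ⟨LinearMap.ker_eq_bot.mp hker, hsurj⟩
  have hf : f (gen _) = gen _ := hψ
  refine ⟨f, isGraded_of_map_gen hf, isGraded_of_map_gen ?_, hf⟩
  exact f.symm_apply_eq.mpr hf.symm

end Comparison

/-! ### The dichotomy for interlacing pairs -/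

section Interlacing

variable {L : Type*} [LieRing L] [LieAlgebra ℂ L] [FiniteDimensional ℂ L]
  [LieAlgebra.IsKilling ℂ L] {H : LieSubalgebra ℂ L} [H.IsCartanSubalgebra]
  {b : (rootSystem H).Base} {lam mu : Dual ℂ H}

theorem pairing_eq_cartanMatrix {X : SLType} {n : ℕ} {e : Fin n ≃ b.support}
    (he : ∀ i j, b.cartanMatrix (e i) (e j) = X.cartanMatrix n i j) (k l : Fin n) :
    (rootSystem H).pairing (e k) (e l) = ((X.cartanMatrix n k l : ℤ) : ℂ) := by
  rw [← he, ← RootPairing.Base.algebraMap_cartanMatrixIn_apply (S := ℤ)]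
  rfl

theorem pairing_comm_of_cartanMatrix {X : SLType} {n : ℕ} (hn : X.minRank ≤ n)
    {e : Fin n ≃ b.support} (he : ∀ i j, b.cartanMatrix (e i) (e j) = X.cartanMatrix n i j)
    (i j : H.root) : (rootSystem H).pairing i j = (rootSystem H).pairing j i := by
  have h := pairing_eq_cartanMatrix he
  cases X with
  | A => exact pairing_comm (fun k l => by rw [h, ← cartanMatrix_A_eq]; rfl) i j
  | D =>
    have hn' : 4 ≤ n := hn
    exact pairing_comm (fun k l => by rw [h, ← cartanMatrix_D_eq (show 3 ≤ n by omega)]; rfl) i j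

theorem exists_minimal_of_isInterlacing {X : SLType} {n : ℕ} (hn : X.minRank ≤ n)
    {e : Fin n ≃ b.support} (he : ∀ i j, b.cartanMatrix (e i) (e j) = X.cartanMatrix n i j)
    (h₁ : IsDominant b lam) (h₂ : IsDominant b mu) (h : IsInterlacing X e lam mu) :
    (∀ i, b.IsPos i → ∃ d : ℤ, (lam - mu) ((rootSystem H).coroot i) = d ∧ |d| ≤ 1) ∨
    ∃ β, b.IsPos β ∧ ∀ γ, b.IsPos γ →
      (∃ d : ℤ, (lam - mu) ((rootSystem H).coroot γ) = d ∧ |d| ≤ 1) ∨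
      ((γ ≠ β → b.height β < b.height γ) ∧
        Relation.ReflTransGen (AddStep b (lam - mu)) β γ) := by
  have hpos : ∀ k, b.IsPos (e k : H.root) := fun k => RootPairing.Base.isPos_of_mem_support (e k).2
  have hle : ∀ k, ev lam (e k) + ev mu (e k) ≤ 1 := fun k => by
    rw [← ev_add h₁ h₂ (hpos k)]
    exact h.1 k
  have hp := pairing_eq_cartanMatrix he
  cases X with
  | A =>
    exact Or.inl fun i _ => exists_abs_le_one_of_alternates_A hp (lam - mu) hle h.2.1 h.2.2
      (fun k => sub_apply_coroot h₁ h₂ (hpos k)) i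
  | D =>
    have hn' : 4 ≤ n := hn
    exact exists_minimal_of_alternates_D (by omega) hp (lam - mu) hle h.2.1 h.2.2
      (fun k => sub_apply_coroot h₁ h₂ (hpos k))

/-- The dichotomy for an interlacing pair, from the combinatorial description of the roots whose
relations may fail. -/
theorem exists_equiv_or_exists_exact
    (hsym : ∀ i j : H.root, (rootSystem H).pairing i j = (rootSystem H).pairing j i)
    (h₁ : IsDominant b lam) (h₂ : IsDominant b mu)
    (h : (∀ i, b.IsPos i → ∃ d : ℤ, (lam - mu) ((rootSystem H).coroot i) = d ∧ |d| ≤ 1) ∨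
      ∃ β, b.IsPos β ∧ ∀ γ, b.IsPos γ →
        (∃ d : ℤ, (lam - mu) ((rootSystem H).coroot γ) = d ∧ |d| ≤ 1) ∨
        ((γ ≠ β → b.height β < b.height γ) ∧
          Relation.ReflTransGen (AddStep b (lam - mu)) β γ))
    (y : H.root → L)
    (hy : ∀ α : H.root, b.IsPos α → y α ∈ rootSpace H (-α.1) ∧ y α ≠ 0) :
    (∃ f : V b lam mu ≃ₗ[CurrentEnv L] Demazure b 2 (lam + mu),
      IsGraded f.toLinearMap ∧ IsGraded f.symm.toLinearMap ∧ f (gen _) = gen _) ∨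
    ∃ β : H.root, b.IsPos β ∧ kerVec b lam mu y β ≠ 0 ∧
      (∀ γ : H.root, b.IsPos γ → kerVec b lam mu y γ ≠ 0 → γ ≠ β → b.height β < b.height γ) ∧
      ∃ ψ : V b lam mu →ₗ[CurrentEnv L] Demazure b 2 (lam + mu),
        IsGraded ψ ∧ ψ (gen _) = gen _ ∧
        Function.Injective (Submodule.span (CurrentEnv L) {kerVec b lam mu y β}).subtype ∧
        Function.Exact (Submodule.span (CurrentEnv L) {kerVec b lam mu y β}).subtype ψ ∧
        Function.Surjective ψ := by
  have hker : ∀ α, kerVec b lam mu y α =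
      cur (y α) ((ev (lam + mu) α + 1) / 2) • gen (vRel b lam mu) := fun α => by
    rw [kerVec, natCeil_half]
  rcases h with hall | ⟨β, hβ, hall⟩
  · exact Or.inl (exists_equiv_of_forall_eq_zero hsym h₁ h₂ fun α hα y hy =>
      cur_smul_gen_eq_zero_of_abs_le_one h₁ h₂ hα (hall α hα) hy)
  have hmem : ∀ γ : H.root, b.IsPos γ → ∀ x ∈ rootSpace H (-γ.1),
      cur x ((ev (lam + mu) γ + 1) / 2) • gen (vRel b lam mu) ∈
        Submodule.span (CurrentEnv L) {kerVec b lam mu y β} := by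
    intro γ hγ x hx
    rcases hall γ hγ with hγ1 | ⟨-, hγ1⟩
    · rw [cur_smul_gen_eq_zero_of_abs_le_one h₁ h₂ hγ hγ1 hx]
      exact Submodule.zero_mem _
    · refine cur_smul_gen_mem_of_reflTransGen hsym h₁ h₂ _ hγ1 (fun z hz => ?_) x hx
      obtain ⟨c, rfl⟩ := exists_eq_smul_of_mem_rootSpace_neg hz (hy β hβ).1 (hy β hβ).2
      rw [cur_smul, Algebra.smul_def, mul_smul, ← hker]
      exact Submodule.smul_mem _ _ (Submodule.mem_span_singleton_self _)
  -- All linear Demazure relations lie in `⟨v_β⟩`, so `v_β = 0` makes every one of them hold in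
  -- `V(λ, μ)`.
  by_cases h0 : kerVec b lam mu y β = 0
  · refine Or.inl (exists_equiv_of_forall_eq_zero hsym h₁ h₂ fun α hα x hx => ?_)
    have := hmem α hα x hx
    rwa [h0, Submodule.span_zero_singleton, Submodule.mem_bot] at this
  refine Or.inr ⟨β, hβ, h0, fun γ hγ hγ0 hne => ?_, ?_⟩
  · rcases hall γ hγ with hγ1 | ⟨hγ1, -⟩
    · refine absurd ?_ hγ0
      rw [hker]
      exact cur_smul_gen_eq_zero_of_abs_le_one h₁ h₂ hγ hγ1 (hy γ hγ).1
    · exact hγ1 hne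
  · obtain ⟨ψ, hψ, hsurj, hkerψ⟩ := exists_map_ker_eq (smul_gen_demazure_eq_zero h₁ h₂)
      (Submodule.span (CurrentEnv L) {kerVec b lam mu y β})
      (smul_gen_mem_of_mem_demazureRel hsym h₁ h₂ _ hmem) (by
        intro v hv
        obtain ⟨u, rfl⟩ := Submodule.mem_span_singleton.mp hv
        refine ⟨u * cur (y β) ((ev (lam + mu) β + 1) / 2), ?_, by rw [mul_smul, ← hker]⟩
        rw [← smul_eq_mul]
        refine Submodule.smul_mem _ _ (Submodule.subset_span (Or.inr ⟨β, hβ, _, (hy β hβ).1, _,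
          ev (lam + mu) β + 2 - 2 * ((ev (lam + mu) β + 1) / 2), by omega, by omega, by omega,
          Or.inl rfl⟩)))
    refine ⟨ψ, isGraded_of_map_gen hψ, hψ, Submodule.subtype_injective _, ?_, hsurj⟩
    rw [LinearMap.exact_iff, hkerψ, Submodule.range_subtype]

end Interlacing

end CurrentAlg

end

theorem mainTheorem4 {L : Type*} [LieRing L] [LieAlgebra ℂ L] [FiniteDimensional ℂ L]
    [LieAlgebra.IsSimple ℂ L] (H : LieSubalgebra ℂ L) [H.IsCartanSubalgebra]
    (b : (rootSystem H).Base)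
    (X : CurrentAlg.SLType) (n : ℕ) (hn : X.minRank ≤ n) (e : Fin n ≃ b.support)
    (he : ∀ i j, b.cartanMatrix (e i) (e j) = X.cartanMatrix n i j)
    (y : H.root → L)
    (hy : ∀ α : H.root, b.IsPos α → y α ∈ rootSpace H (-α.1) ∧ y α ≠ 0)
    (ν₁ ν₂ : Dual ℂ H) (h₁ : CurrentAlg.IsDominant b ν₁) (h₂ : CurrentAlg.IsDominant b ν₂)
    (h : CurrentAlg.IsInterlacing X e ν₁ ν₂) :
    (∃ f : CurrentAlg.V b ν₁ ν₂ ≃ₗ[CurrentAlg.CurrentEnv L] CurrentAlg.Demazure b 2 (ν₁ + ν₂),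
      CurrentAlg.IsGraded f.toLinearMap ∧ CurrentAlg.IsGraded f.symm.toLinearMap ∧
      f (CurrentAlg.gen _) = CurrentAlg.gen _) ∨
    ∃ β : H.root, b.IsPos β ∧ CurrentAlg.kerVec b ν₁ ν₂ y β ≠ 0 ∧
      (∀ γ : H.root, b.IsPos γ → CurrentAlg.kerVec b ν₁ ν₂ y γ ≠ 0 → γ ≠ β →
        b.height β < b.height γ) ∧
      ∃ ψ : CurrentAlg.V b ν₁ ν₂ →ₗ[CurrentAlg.CurrentEnv L] CurrentAlg.Demazure b 2 (ν₁ + ν₂),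
        CurrentAlg.IsGraded ψ ∧ ψ (CurrentAlg.gen _) = CurrentAlg.gen _ ∧
        Function.Injective
          (Submodule.span (CurrentAlg.CurrentEnv L) {CurrentAlg.kerVec b ν₁ ν₂ y β}).subtype ∧
        Function.Exact
          (Submodule.span (CurrentAlg.CurrentEnv L) {CurrentAlg.kerVec b ν₁ ν₂ y β}).subtype ψ ∧
        Function.Surjective ψ := by
  exact CurrentAlg.exists_equiv_or_exists_exact (CurrentAlg.pairing_comm_of_cartanMatrix hn he) h₁ h₂
    (CurrentAlg.exists_minimal_of_isInterlacing hn he h₁ h₂ h) y hy
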